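/- Let $M$ be a (Hausdorff) topological Lusin space, $\mathfrak m$ a $\sigma$-finite Borel measure on $M$ with full support, and $(\mathcal E,\mathcal F)$ a symmetric, quasi-regular, strongly local Dirichlet form on $L^2(M,\mathfrak m)$. Let $\mathcal F_e$ be its extended domain (all $\mathfrak m$-a.e. limits of $\mathcal E$-Cauchy sequences in $\mathcal F$), and let $\boldsymbol\mu\colon\mathcal F_e\times\mathcal F_e\to\{\text{finite signed Borel measures charging no }\mathcal E\text{-polar sets}\}$ be its energy measure, i.e. the symmetric bilinear map, nonnegative on the diagonal, with $2\int_M\tilde h\,\mathrm d\boldsymbol\mu_{f,g}=\mathcal E(fh,g)+\mathcal E(gh,f)-\mathcal E(fg,h)$ for $f,g,h\in\mathcal F\cap L^\infty(M,\mathfrak m)$ ($\tilde h$ an $\mathcal E$-quasi-continuous version of $h$), extended to $\mathcal F_e$ by approximation; put $\boldsymbol\mu_f=\boldsymbol\mu_{f,f}$. Let $\mathrm{Pcm}$ be the set of sequences $(f_i,A_i)_{i\in\mathbb N}$, where $(A_i)$ is a Borel partition of $M$, $f_i\in\mathcal F_e$ and $\sum_i\boldsymbol\mu_{f_i}[A_i]<\infty$,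 modulo the equivalence relation $(f_i,A_i)\sim(g_j,B_j)$ iff $\boldsymbol\mu_{f_i-g_j}[A_i\cap B_j]=0$ for all $i,j$. With the operations $[f_i,A_i]+[g_j,B_j]=[f_i+g_j,A_i\cap B_j]$ and $\lambda[f_i,A_i]=[\lambda f_i,A_i]$ and the norm $\|[f_i,A_i]\|^2=\sum_i\boldsymbol\mu_{f_i}[A_i]$ the set of classes is a normed space; the cotangent module $L^2(T^*M)$ is its completion. For $f\in\mathcal F_e$ put $\mathrm df=[f,M]$. Let $\mu$ be any $\mathcal E$-dominant measure, i.e. a $\sigma$-finite Borel measure on $M$ with $\boldsymbol\mu_f\ll\mu$ for all $f\in\mathcal F$, and let $\Gamma_\mu(f,g)$ be the density of $\boldsymbol\mu_{f,g}$ with respect to $\mu$, $\Gamma_\mu(f)=\Gamma_\mu(f,f)$. An $L^2$-normed $L^\infty$-module with respect to $\mu$ is a real Banach space $V$ with a bilinear multiplication $L^\infty(M,\mu)\times V\to V$ such that $(fg)v=f(gv)$, $1v=v$, and a nonnegative pointwise norm $|\cdot|_\mu\colon V\to L^2(M,\mu)$ such that $|fv|_\mu=|f|\,|v|_\mu$ $\mu$-a.e.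 and $\|v\|=\||v|_\mu\|_{L^2(M,\mu)}$; it is a Hilbert module if in addition $V$ is a Hilbert space. Then: 1. $L^2(T^*M)$ is an $L^2$-normed $L^\infty$-module with respect to $\mu$, in fact a Hilbert module. Its multiplication extends the multiplication $h[f_i,A_i]=[h_jf_i,A_i\cap B_j]$ by simple functions $h=\sum_jh_j1_{B_j}$ (where $(B_j)$ is a partition of $M$), and its pointwise norm satisfies $|[f_i,A_i]|_\mu=\sum_i1_{A_i}\Gamma_\mu(f_i)^{1/2}$ $\mu$-a.e. 2. The map $\mathrm d\colon\mathcal F_e\to L^2(T^*M)$ is linear, and $|\mathrm df|_\mu=\Gamma_\mu(f)^{1/2}$ $\mu$-a.e. for every $f\in\mathcal F_e$. 3. The tangent module $L^2(TM)$ with respect to $\mu$, that is the space of bounded linear maps $X\colon L^2(T^*M)\to L^1(M,\mu)$ with $X(f\omega)=f\,X(\omega)$ for $f\in L^\infty(M,\mu)$, with the operator norm, the multiplication $(fX)(\omega)=f\,X(\omega)$ and the pointwise norm $|X|_\mu=\mu\text{-ess sup}\{|X(\omega)|:|\omega|_\mu\le1\ \mu\text{-a.e.}\}$, is also an $L^2$-normed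 $L^\infty$-module and a Hilbert module. 4. There is a linear map $\nabla\colon\mathcal F_e\to L^2(TM)$, the gradient $\nabla f=(\mathrm df)^\sharp$, i.e. $(\nabla f)(\omega)=\langle\mathrm df,\omega\rangle_\mu$ $\mu$-a.e. for all $\omega\in L^2(T^*M)$ with $\langle v,w\rangle_\mu=\frac14(|v+w|_\mu^2-|v-w|_\mu^2)$, and $|\nabla f|_\mu=|\mathrm df|_\mu=\Gamma_\mu(f)^{1/2}$ $\mu$-a.e. for every $f\in\mathcal F_e$. In particular, if $\mathfrak m$ itself is $\mathcal E$-dominant (i.e. $\mathcal E$ admits a carré du champ $\Gamma=\Gamma_{\mathfrak m}$), all this holds with $\mu=\mathfrak m$. -/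

import Mathlib

open MeasureTheory Filter Topology Set
open scoped ENNReal

noncomputable section

/-- A topological Lusin space: a Hausdorff space that is a continuous injective image of a Polish
space, i.e. whose topology is coarser than some Polish topology on the same set. -/
def IsLusinSpace (M : Type*) [t : TopologicalSpace M] : Prop :=
  T2Space M ∧ ∃ s : TopologicalSpace M, s ≤ t ∧ @PolishSpace M s

/-- A symmetric Dirichlet form `(E, F)` on `L²(M, m)`: a symmetric nonnegative definite bilinear
form on a dense subspace `F = domain` of `L²(M, m)` that is closed and Markovian. -/
structure DirichletForm {M : Type*} [MeasurableSpace M] (m : Measure M) where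
  domain : Submodule ℝ (M →ₘ[m] ℝ)
  form : LinearMap.BilinForm ℝ domain
  domain_le : ∀ f ∈ domain, f ∈ Lp ℝ 2 m
  dense : Dense {f : Lp ℝ 2 m | (f : M →ₘ[m] ℝ) ∈ domain}
  symm : ∀ f g, form f g = form g f
  nonneg : ∀ f, 0 ≤ form f f
  /-- completeness of `domain` for the norm `(‖f‖²_{L²} + E(f))^{1/2}` -/
  closed : ∀ u : ℕ → domain,
    Tendsto (fun p : ℕ × ℕ => (∫ x, ((u p.1 - u p.2 : domain) : M →ₘ[m] ℝ) x ^ 2 ∂m)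
      + form (u p.1 - u p.2) (u p.1 - u p.2)) atTop (𝓝 0) →
    ∃ v : domain, Tendsto (fun n => (∫ x, ((u n - v : domain) : M →ₘ[m] ℝ) x ^ 2 ∂m)
      + form (u n - v) (u n - v)) atTop (𝓝 0)
  /-- `min {f⁺, 1} ∈ domain` and `E(min {f⁺, 1}) ≤ E(f)` -/
  markovian : ∀ f : domain, ∃ h : ((f : M →ₘ[m] ℝ) ⊔ 0) ⊓ 1 ∈ domain,
    form ⟨((f : M →ₘ[m] ℝ) ⊔ 0) ⊓ 1, h⟩ ⟨((f : M →ₘ[m] ℝ) ⊔ 0) ⊓ 1, h⟩ ≤ form f f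

namespace DirichletForm

section Forms

variable {M : Type*} [MeasurableSpace M] {m : Measure M} (E : DirichletForm m)

/-- `‖f‖_F² = ‖f‖²_{L²} + E(f)`. -/
def normSq (f : E.domain) : ℝ := (∫ x, (f : M →ₘ[m] ℝ) x ^ 2 ∂m) + E.form f f

/-- The sequence `u` in the domain is `E`-Cauchy. -/
def IsECauchy (u : ℕ → E.domain) : Prop :=
  Tendsto (fun p : ℕ × ℕ => E.form (u p.1 - u p.2) (u p.1 - u p.2)) atTop (𝓝 0)

/-- `u` is an `E`-Cauchy sequence in the domain that converges to `f` almost everywhere, i.e.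
`u` converges to `f` in the extended domain. -/
def ConvergesTo (u : ℕ → E.domain) (f : M →ₘ[m] ℝ) : Prop :=
  E.IsECauchy u ∧ ∀ᵐ x ∂m, Tendsto (fun n => (u n : M →ₘ[m] ℝ) x) atTop (𝓝 (f x))

theorem form_add_le (f g : E.domain) :
    E.form (f + g) (f + g) ≤ 2 * E.form f f + 2 * E.form g g := by
  have h := E.nonneg (f - g)
  simp only [map_add, map_sub, LinearMap.add_apply, LinearMap.sub_apply] at h ⊢
  linarith

theorem ConvergesTo.add {u v : ℕ → E.domain} {f g : M →ₘ[m] ℝ} (hu : E.ConvergesTo u f)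
    (hv : E.ConvergesTo v g) : E.ConvergesTo (fun n => u n + v n) (f + g) := by
  constructor
  · have h := (hu.1.const_mul 2).add (hv.1.const_mul 2)
    simp only [mul_zero, add_zero] at h
    refine squeeze_zero (fun p => E.nonneg _) (fun p => ?_) h
    have e : u p.1 + v p.1 - (u p.2 + v p.2) = (u p.1 - u p.2) + (v p.1 - v p.2) := by abel
    simp only [e]
    exact E.form_add_le _ _
  · have h1 : ∀ᵐ x ∂m, ∀ n, ((u n + v n : E.domain) : M →ₘ[m] ℝ) x
        = (u n : M →ₘ[m] ℝ) x + (v n : M →ₘ[m] ℝ) x :=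
      ae_all_iff.2 fun n => AEEqFun.coeFn_add _ _
    filter_upwards [hu.2, hv.2, h1, AEEqFun.coeFn_add f g] with x h2 h3 h4 h5
    simp only [h4, h5, Pi.add_apply]
    exact h2.add h3

theorem ConvergesTo.smul {u : ℕ → E.domain} {f : M →ₘ[m] ℝ} (c : ℝ)
    (hu : E.ConvergesTo u f) : E.ConvergesTo (fun n => c • u n) (c • f) := by
  constructor
  · have h := hu.1.const_mul (c * c)
    simp only [mul_zero] at h
    refine h.congr fun p => ?_
    have e : c • u p.1 - c • u p.2 = c • (u p.1 - u p.2) := (smul_sub _ _ _).symm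
    simp only [e, map_smul, LinearMap.smul_apply, smul_eq_mul]
    ring
  · have h1 : ∀ᵐ x ∂m, ∀ n, ((c • u n : E.domain) : M →ₘ[m] ℝ) x
        = c * (u n : M →ₘ[m] ℝ) x :=
      ae_all_iff.2 fun n => AEEqFun.coeFn_smul c _
    filter_upwards [hu.2, h1, AEEqFun.coeFn_smul c f] with x h2 h4 h5
    simp only [h4, h5, Pi.smul_apply, smul_eq_mul]
    exact h2.const_mul c

theorem convergesTo_const (f : E.domain) : E.ConvergesTo (fun _ => f) (f : M →ₘ[m] ℝ) := by
  refine ⟨?_, ae_of_all _ fun x => tendsto_const_nhds⟩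
  simp [IsECauchy]

/-- The extended domain `F_e`: all (classes of) real measurable functions that are a.e. limits of
`E`-Cauchy sequences in the domain. -/
def extendedDomain : Submodule ℝ (M →ₘ[m] ℝ) where
  carrier := {f | ∃ u : ℕ → E.domain, E.ConvergesTo u f}
  add_mem' := by
    rintro f g ⟨u, hu⟩ ⟨v, hv⟩
    exact ⟨_, ConvergesTo.add E hu hv⟩
  zero_mem' := ⟨_, E.convergesTo_const 0⟩
  smul_mem' := by
    rintro c f ⟨u, hu⟩
    exact ⟨_, ConvergesTo.smul E c hu⟩

theorem domain_le_extendedDomain : E.domain ≤ E.extendedDomain :=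
  fun f hf => ⟨_, E.convergesTo_const ⟨f, hf⟩⟩

/-- The inclusion of the domain in the extended domain. -/
def incl : E.domain →ₗ[ℝ] E.extendedDomain := Submodule.inclusion E.domain_le_extendedDomain

end Forms

section Quasi

variable {M : Type*} [TopologicalSpace M] [MeasurableSpace M] {m : Measure M}
  (E : DirichletForm m)

/-- An `E`-nest: an increasing sequence of closed sets `F k` such that the functions in the domain
that vanish a.e. outside some `F k` are dense in the domain. -/
def IsNest (F : ℕ → Set M) : Prop :=
  Monotone F ∧ (∀ k, IsClosed (F k)) ∧
    ∀ (f : E.domain) (ε : ℝ), 0 < ε → ∃ (k : ℕ) (g : E.domain),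
      (∀ᵐ x ∂m, x ∉ F k → (g : M →ₘ[m] ℝ) x = 0) ∧ E.normSq (f - g) < ε

/-- `E`-polar (exceptional) sets. -/
def IsPolar (N : Set M) : Prop :=
  ∃ F : ℕ → Set M, E.IsNest F ∧ N ⊆ ⋂ k, (F k)ᶜ

/-- `f'` is an `E`-quasi-continuous `m`-version of `f`. -/
def IsQCVersion (f : M →ₘ[m] ℝ) (f' : M → ℝ) : Prop :=
  f' =ᵐ[m] f ∧ ∃ F : ℕ → Set M, E.IsNest F ∧ ∀ k, ContinuousOn f' (F k)

/-- Quasi-regularity: there is an `E`-nest of compact sets, a dense set of functions in the domain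
have quasi-continuous versions, and countably many functions in the domain have quasi-continuous
versions that together separate the points outside a polar set. -/
def IsQuasiRegular : Prop :=
  (∃ F : ℕ → Set M, E.IsNest F ∧ ∀ k, IsCompact (F k)) ∧
  (∀ (f : E.domain) (ε : ℝ), 0 < ε → ∃ (g : E.domain) (g' : M → ℝ),
    E.IsQCVersion g g' ∧ E.normSq (f - g) < ε) ∧
  ∃ (u : ℕ → E.domain) (u' : ℕ → M → ℝ) (N : Set M), E.IsPolar N ∧
    (∀ n, E.IsQCVersion (u n) (u' n)) ∧
    ∀ x ∉ N, ∀ y ∉ N, x ≠ y → ∃ n, u' n x ≠ u' n y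

/-- The support of (the class of) a measurable function: the support of the measure `|f| m`. -/
def supp (f : M →ₘ[m] ℝ) : Set M := (m.withDensity fun x => ‖f x‖ₑ).support

/-- Strong locality: `E(f, g) = 0` whenever `f` and `g` have compact support and `f` is constant
on a neighbourhood of the support of `g`. -/
def IsStronglyLocal : Prop :=
  ∀ f g : E.domain, IsCompact (supp (f : M →ₘ[m] ℝ)) → IsCompact (supp (g : M →ₘ[m] ℝ)) →
    (∃ (U : Set M) (c : ℝ), IsOpen U ∧ supp (g : M →ₘ[m] ℝ) ⊆ U ∧
      ∀ᵐ x ∂m, x ∈ U → (f : M →ₘ[m] ℝ) x = c) →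
    E.form f g = 0

/-- The integral of a function with respect to a finite signed measure. -/
def signedIntegral (ν : SignedMeasure M) (h : M → ℝ) : ℝ :=
  (∫ x, h x ∂ν.toJordanDecomposition.posPart) - ∫ x, h x ∂ν.toJordanDecomposition.negPart

/-- The defining properties of the energy measure of `E`. It is a symmetric bilinear map on the
extended domain with values in the finite signed Borel measures that charge no polar sets, it is
nonnegative on the diagonal, it satisfies
`2 ∫ h' dμ_{f,g} = E(f h, g) + E(g h, f) - E(f g, h)` for bounded `f, g, h` in the domain and any
quasi-continuous version `h'` of `h`, and on the extended domain it is obtained by approximation.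
(The products `f h`, `g h`, `f g` belong to the domain, as its bounded elements form an algebra;
finite Borel measures on a Lusin space are Radon.) -/
structure IsEnergyMeasure
    (ν : E.extendedDomain →ₗ[ℝ] E.extendedDomain →ₗ[ℝ] SignedMeasure M) : Prop where
  symm : ∀ f g, ν f g = ν g f
  nonneg : ∀ f A, 0 ≤ ν f f A
  polar : ∀ f g N, MeasurableSet N → E.IsPolar N → ν f g N = 0
  integral : ∀ f g h fh gh fg : E.domain,
    (f : M →ₘ[m] ℝ) ∈ Lp ℝ ∞ m → (g : M →ₘ[m] ℝ) ∈ Lp ℝ ∞ m → (h : M →ₘ[m] ℝ) ∈ Lp ℝ ∞ m →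
    (fh : M →ₘ[m] ℝ) = f * h → (gh : M →ₘ[m] ℝ) = g * h → (fg : M →ₘ[m] ℝ) = f * g →
    ∀ h' : M → ℝ, E.IsQCVersion h h' →
      2 * signedIntegral (ν (E.incl f) (E.incl g)) h'
        = E.form fh g + E.form gh f - E.form fg h
  approx : ∀ (u : ℕ → E.domain) (f : E.extendedDomain), E.ConvergesTo u f →
    ∀ A, MeasurableSet A →
      Tendsto (fun n => ν (E.incl (u n)) (E.incl (u n)) A) atTop (𝓝 (ν f f A))

open Classical in
/-- The energy measure `(f, g) ↦ μ_{f,g}` of `E`: the map with the properties `IsEnergyMeasure`,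
which exists and is unique for every quasi-regular, strongly local `E`. (The value zero is only a
default for forms that have no energy measure.) -/
def energyMeasure : E.extendedDomain →ₗ[ℝ] E.extendedDomain →ₗ[ℝ] SignedMeasure M :=
  if h : ∃ ν, E.IsEnergyMeasure ν then h.choose else 0

theorem energyMeasure_symm (f g : E.extendedDomain) :
    E.energyMeasure f g = E.energyMeasure g f := by
  unfold energyMeasure
  split_ifs with h
  · exact h.choose_spec.symm f g
  · rfl

theorem energyMeasure_nonneg (f : E.extendedDomain) (A : Set M) :
    0 ≤ E.energyMeasure f f A := by
  unfold energyMeasure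
  split_ifs with h
  · exact h.choose_spec.nonneg f A
  · exact le_rfl

/-- A Borel measure `μ` is `E`-dominant if it is `σ`-finite and `μ_f ≪ μ` for every `f` in the
domain. -/
def IsDominant (μ : Measure M) : Prop :=
  SigmaFinite μ ∧ ∀ (f : E.domain) (A : Set M), MeasurableSet A → μ A = 0 →
    E.energyMeasure (E.incl f) (E.incl f) A = 0

/-- `Γ_μ(f, g)`, the density of `μ_{f,g}` with respect to `μ`. -/
def carreDuChamp (μ : Measure M) (f g : E.extendedDomain) : M → ℝ :=
  (E.energyMeasure f g).rnDeriv μ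

/-- The bilinear form `(f, g) ↦ μ_{f,g}[A]`. -/
def energyOn (A : Set M) : LinearMap.BilinForm ℝ E.extendedDomain :=
  LinearMap.mk₂ ℝ (fun f g => E.energyMeasure f g A)
    (fun f f' g => by simp [map_add, LinearMap.add_apply])
    (fun c f g => by simp)
    (fun f g g' => by simp)
    (fun c f g => by simp)

theorem energyOn_apply (A : Set M) (f g : E.extendedDomain) :
    E.energyOn A f g = E.energyMeasure f g A := rfl

theorem energyOn_nonneg (A : Set M) (f : E.extendedDomain) : 0 ≤ E.energyOn A f f :=
  E.energyMeasure_nonneg f A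

theorem energyOn_symm (A : Set M) (f g : E.extendedDomain) :
    E.energyOn A f g = E.energyOn A g f := by
  rw [energyOn_apply, energyOn_apply, energyMeasure_symm]

theorem energyOn_mono {A B : Set M} (hA : MeasurableSet A) (hB : MeasurableSet B) (h : A ⊆ B)
    (f : E.extendedDomain) : E.energyOn A f f ≤ E.energyOn B f f := by
  have := VectorMeasure.of_add_of_sdiff (v := E.energyMeasure f f) hA hB h
  have h2 := E.energyMeasure_nonneg f (B \ A)
  simp only [energyOn_apply]
  linarith

theorem energyOn_empty (f g : E.extendedDomain) : E.energyOn ∅ f g = 0 := by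
  simp [energyOn_apply]

theorem energyOn_add_le (A : Set M) (f g : E.extendedDomain) {t : ℝ} (ht : 0 < t) :
    E.energyOn A (f + g) (f + g)
      ≤ (1 + t) * E.energyOn A f f + (1 + t⁻¹) * E.energyOn A g g := by
  have h := E.energyOn_nonneg A (t • f - g)
  have hs := E.energyOn_symm A g f
  simp only [map_add, map_sub, map_smul, LinearMap.add_apply, LinearMap.sub_apply,
    LinearMap.smul_apply, smul_eq_mul, hs] at h ⊢
  have h2 : 0 ≤ t⁻¹ * (t * (t * E.energyOn A f f) - E.energyOn A f g * t
      - (t * E.energyOn A f g - E.energyOn A g g)) := by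
    apply mul_nonneg (by positivity)
    linarith
  have h3 : t⁻¹ * (t * (t * E.energyOn A f f) - E.energyOn A f g * t
      - (t * E.energyOn A f g - E.energyOn A g g))
      = t * E.energyOn A f f - 2 * E.energyOn A f g + t⁻¹ * E.energyOn A g g := by
    field_simp
    ring
  linarith

theorem energyOn_eq_of_sub {A : Set M} {f g : E.extendedDomain}
    (h : E.energyOn A (f - g) (f - g) = 0) : E.energyOn A f f = E.energyOn A g g := by
  have key : ∀ k, E.energyOn A (f - g) k = 0 := by
    intro k
    have := LinearMap.BilinForm.apply_sq_le_of_symm (E.energyOn A) (E.energyOn_nonneg A)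
      ⟨fun x y => E.energyOn_symm A x y⟩ (f - g) k
    rw [h, zero_mul] at this
    exact pow_eq_zero_iff (two_ne_zero) |>.1 (le_antisymm this (sq_nonneg _))
  have h1 := key f
  have h2 := key g
  have h3 := E.energyOn_symm A f g
  simp only [map_sub, LinearMap.sub_apply] at h1 h2
  linarith

end Quasi

section Cotangent

variable {M : Type*} [TopologicalSpace M] [MeasurableSpace M] {m : Measure M}
  (E : DirichletForm m)

/-- The pre-cotangent module: sequences `(f_i, A_i)` of functions `f_i` in the extended domain and
of Borel sets `A_i` that partition `M`, with `∑ i, μ_{f_i}[A_i] < ∞`. -/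
structure PreCotangent where
  f : ℕ → E.extendedDomain
  A : ℕ → Set M
  measurable : ∀ i, MeasurableSet (A i)
  disjoint : Pairwise (Function.onFun Disjoint A)
  cover : ⋃ i, A i = univ
  summable : Summable fun i => E.energyOn (A i) (f i) (f i)

namespace PreCotangent

variable {E}

/-- The equivalence relation: `μ_{f_i - g_j}[A_i ∩ B_j] = 0` for all `i, j`. -/
def Rel (P Q : PreCotangent E) : Prop :=
  ∀ i j, E.energyOn (P.A i ∩ Q.A j) (P.f i - Q.f j) (P.f i - Q.f j) = 0

/-- `∑ i, μ_{f_i}[A_i]`. -/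
def normSq (P : PreCotangent E) : ℝ := ∑' i, E.energyOn (P.A i) (P.f i) (P.f i)

theorem exists_mem (P : PreCotangent E) (x : M) : ∃ i, x ∈ P.A i := by
  have : x ∈ ⋃ i, P.A i := by rw [P.cover]; trivial
  simpa using this

theorem eq_of_mem (P : PreCotangent E) {x : M} {i j : ℕ} (hi : x ∈ P.A i) (hj : x ∈ P.A j) :
    i = j := by
  by_contra h
  exact Set.disjoint_left.1 (P.disjoint h) hi hj

/-- The function in the extended domain that is prescribed at the point `x`. -/
def val (P : PreCotangent E) (x : M) : E.extendedDomain := P.f (P.exists_mem x).choose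

theorem val_eq (P : PreCotangent E) {x : M} {i : ℕ} (hi : x ∈ P.A i) : P.val x = P.f i := by
  unfold val
  rw [P.eq_of_mem (P.exists_mem x).choose_spec hi]

theorem rel_of_val_eq {P Q : PreCotangent E} (h : ∀ x, P.val x = Q.val x) : Rel P Q := by
  intro i j
  rcases (P.A i ∩ Q.A j).eq_empty_or_nonempty with h0 | ⟨x, hx⟩
  · rw [h0, energyOn_empty]
  · have : P.f i = Q.f j := by rw [← P.val_eq hx.1, ← Q.val_eq hx.2, h]
    simp [this]

/-- Splitting the sets of a partition by another countable partition. -/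
theorem hasSum_inter (P : PreCotangent E) {κ : Type*} [Countable κ] {B : κ → Set M}
    (hB : ∀ j, MeasurableSet (B j)) (hd : Pairwise (Function.onFun Disjoint B))
    (hc : ⋃ j, B j = univ) :
    HasSum (fun p : ℕ × κ => E.energyOn (P.A p.1 ∩ B p.2) (P.f p.1) (P.f p.1)) P.normSq := by
  have h1 : ∀ i, HasSum (fun j => E.energyOn (P.A i ∩ B j) (P.f i) (P.f i))
      (E.energyOn (P.A i) (P.f i) (P.f i)) := by
    intro i
    have := VectorMeasure.hasSum_of_disjoint_iUnion
      (v := E.energyMeasure (P.f i) (P.f i)) (f := fun j => P.A i ∩ B j)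
      (fun j => (P.measurable i).inter (hB j))
      (fun j k hjk => (hd hjk).mono inter_subset_right inter_subset_right)
    rwa [← inter_iUnion, hc, inter_univ] at this
  have hs : Summable fun p : ℕ × κ =>
      E.energyOn (P.A p.1 ∩ B p.2) (P.f p.1) (P.f p.1) := by
    refine (summable_prod_of_nonneg fun p => E.energyOn_nonneg _ _).2 ⟨fun i => (h1 i).summable, ?_⟩
    exact P.summable.congr fun i => ((h1 i).tsum_eq).symm
  have h2 := hs.hasSum.prod_fiberwise h1
  rw [normSq, h2.tsum_eq]
  exact hs.hasSum

/-- An element of the pre-cotangent module from a family with a countable index set. -/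
def ofCountable {ι : Type*} [Encodable ι] (f : ι → E.extendedDomain) (A : ι → Set M)
    (hm : ∀ i, MeasurableSet (A i)) (hd : Pairwise (Function.onFun Disjoint A))
    (hc : ⋃ i, A i = univ) (hs : Summable fun i => E.energyOn (A i) (f i) (f i)) :
    PreCotangent E where
  f n := (Encodable.decode₂ ι n).elim 0 f
  A n := (Encodable.decode₂ ι n).elim ∅ A
  measurable n := by
    cases h : Encodable.decode₂ ι n <;> simp [hm]
  disjoint n k hnk := by
    simp only [Function.onFun]
    cases h : Encodable.decode₂ ι n <;> cases h' : Encodable.decode₂ ι k <;> simp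
    rename_i i j
    refine hd fun hij => hnk ?_
    rw [← Encodable.mem_decode₂.1 h, ← Encodable.mem_decode₂.1 h', hij]
  cover := by
    refine eq_univ_of_forall fun x => ?_
    have hx : x ∈ ⋃ i, A i := by rw [hc]; trivial
    obtain ⟨i, hi⟩ := mem_iUnion.1 hx
    refine mem_iUnion.2 ⟨Encodable.encode i, ?_⟩
    simpa [Encodable.decode₂_encode] using hi
  summable := by
    refine (Function.Injective.summable_iff (Encodable.encode_injective (α := ι)) ?_).1 ?_
    · intro n hn
      have : Encodable.decode₂ ι n = none := by
        by_contra h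
        exact hn (Encodable.decode₂_ne_none_iff.1 h)
      simp [this]
    · refine hs.congr fun i => ?_
      simp [Encodable.decode₂_encode]

theorem val_ofCountable {ι : Type*} [Encodable ι] {f : ι → E.extendedDomain} {A : ι → Set M}
    {hm : ∀ i, MeasurableSet (A i)} {hd : Pairwise (Function.onFun Disjoint A)}
    {hc : ⋃ i, A i = univ} {hs : Summable fun i => E.energyOn (A i) (f i) (f i)}
    {x : M} {i : ι} (hi : x ∈ A i) : (ofCountable f A hm hd hc hs).val x = f i := by
  have h : x ∈ (ofCountable f A hm hd hc hs).A (Encodable.encode i) := by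
    simpa [ofCountable, Encodable.decode₂_encode] using hi
  rw [val_eq _ h]
  simp [ofCountable, Encodable.decode₂_encode]

theorem normSq_ofCountable {ι : Type*} [Encodable ι] {f : ι → E.extendedDomain} {A : ι → Set M}
    {hm : ∀ i, MeasurableSet (A i)} {hd : Pairwise (Function.onFun Disjoint A)}
    {hc : ⋃ i, A i = univ} {hs : Summable fun i => E.energyOn (A i) (f i) (f i)} :
    (ofCountable f A hm hd hc hs).normSq = ∑' i, E.energyOn (A i) (f i) (f i) := by
  unfold normSq
  rw [← (Encodable.encode_injective (α := ι)).tsum_eq]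
  · simp [ofCountable, Encodable.decode₂_encode]
  · intro n hn
    by_contra h
    have : Encodable.decode₂ ι n = none := by
      by_contra h'
      exact h (Encodable.decode₂_ne_none_iff.1 h')
    exact hn (by simp [ofCountable, this])

theorem disjoint_inter {ι κ : Type*} {A : ι → Set M} {B : κ → Set M}
    (hA : Pairwise (Function.onFun Disjoint A)) (hB : Pairwise (Function.onFun Disjoint B)) :
    Pairwise (Function.onFun Disjoint fun p : ι × κ => A p.1 ∩ B p.2) := by
  intro p q hpq
  by_cases h : p.1 = q.1
  · have h2 : p.2 ≠ q.2 := fun h2 => hpq (Prod.ext h h2)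
    exact (hB h2).mono inter_subset_right inter_subset_right
  · exact (hA h).mono inter_subset_left inter_subset_left

theorem cover_inter {ι κ : Type*} {A : ι → Set M} {B : κ → Set M}
    (hA : ⋃ i, A i = univ) (hB : ⋃ i, B i = univ) :
    ⋃ p : ι × κ, A p.1 ∩ B p.2 = univ := by
  refine eq_univ_of_forall fun x => ?_
  obtain ⟨i, hi⟩ := mem_iUnion.1 (hA ▸ mem_univ x : x ∈ ⋃ i, A i)
  obtain ⟨j, hj⟩ := mem_iUnion.1 (hB ▸ mem_univ x : x ∈ ⋃ i, B i)
  exact mem_iUnion.2 ⟨(i, j), hi, hj⟩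

theorem hasSum_left (P Q : PreCotangent E) :
    HasSum (fun p : ℕ × ℕ => E.energyOn (P.A p.1 ∩ Q.A p.2) (P.f p.1) (P.f p.1)) P.normSq :=
  P.hasSum_inter Q.measurable Q.disjoint Q.cover

theorem hasSum_right (P Q : PreCotangent E) :
    HasSum (fun p : ℕ × ℕ => E.energyOn (P.A p.1 ∩ Q.A p.2) (Q.f p.2) (Q.f p.2)) Q.normSq := by
  have h := (Equiv.prodComm ℕ ℕ).hasSum_iff.2 (Q.hasSum_left P)
  refine h.congr_fun fun p => ?_
  simp [inter_comm]

theorem summable_add (P Q : PreCotangent E) : Summable fun p : ℕ × ℕ =>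
    E.energyOn (P.A p.1 ∩ Q.A p.2) (P.f p.1 + Q.f p.2) (P.f p.1 + Q.f p.2) :=
  Summable.of_nonneg_of_le (fun p => E.energyOn_nonneg _ _)
    (fun p => E.energyOn_add_le _ _ _ one_pos)
    (((P.hasSum_left Q).summable.mul_left _).add ((P.hasSum_right Q).summable.mul_left _))

/-- `(f_i, A_i) + (g_j, B_j) = (f_i + g_j, A_i ∩ B_j)`. -/
def add (P Q : PreCotangent E) : PreCotangent E :=
  ofCountable (fun p : ℕ × ℕ => P.f p.1 + Q.f p.2) (fun p => P.A p.1 ∩ Q.A p.2)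
    (fun p => (P.measurable p.1).inter (Q.measurable p.2)) (disjoint_inter P.disjoint Q.disjoint)
    (cover_inter P.cover Q.cover) (P.summable_add Q)

/-- `c (f_i, A_i) = (c f_i, A_i)`. -/
def smul (c : ℝ) (P : PreCotangent E) : PreCotangent E where
  f i := c • P.f i
  A := P.A
  measurable := P.measurable
  disjoint := P.disjoint
  cover := P.cover
  summable := by
    refine (P.summable.mul_left (c * c)).congr fun i => ?_
    simp [mul_assoc]

theorem range_cover (h : SimpleFunc M ℝ) : ⋃ c : h.range, h ⁻¹' {(c : ℝ)} = univ :=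
  eq_univ_of_forall fun x => mem_iUnion.2 ⟨⟨h x, h.mem_range_self x⟩, rfl⟩

theorem range_disjoint (h : SimpleFunc M ℝ) :
    Pairwise (Function.onFun Disjoint fun c : h.range => h ⁻¹' {(c : ℝ)}) := by
  intro c d hcd
  refine Set.disjoint_left.2 fun x hx hx' => hcd (Subtype.ext ?_)
  exact (show h x = c from hx).symm.trans hx'

theorem summable_simpleSMul (h : SimpleFunc M ℝ) (P : PreCotangent E) :
    Summable fun p : ℕ × h.range =>
      E.energyOn (P.A p.1 ∩ h ⁻¹' {(p.2 : ℝ)}) ((p.2 : ℝ) • P.f p.1) ((p.2 : ℝ) • P.f p.1) := by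
  refine Summable.of_nonneg_of_le (fun p => E.energyOn_nonneg _ _) (fun p => ?_)
    ((P.hasSum_inter (fun c : h.range => h.measurableSet_preimage {(c : ℝ)}) (range_disjoint h)
      (range_cover h)).summable.mul_left (∑ c : h.range, (c : ℝ) * c))
  simp only [map_smul, LinearMap.smul_apply, smul_eq_mul]
  rw [← mul_assoc]
  refine mul_le_mul_of_nonneg_right ?_ (E.energyOn_nonneg _ _)
  exact Finset.single_le_sum (f := fun c : h.range => (c : ℝ) * c)
    (fun c _ => mul_self_nonneg _) (Finset.mem_univ _)

/-- The product of a simple function `h`, with the values `h_j` on the sets `B_j`, and of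
`(f_i, A_i)`: `h (f_i, A_i) = (h_j f_i, A_i ∩ B_j)`. -/
def simpleSMul (h : SimpleFunc M ℝ) (P : PreCotangent E) : PreCotangent E :=
  letI : Encodable h.range := Encodable.ofCountable _
  ofCountable (fun p : ℕ × h.range => (p.2 : ℝ) • P.f p.1)
    (fun p => P.A p.1 ∩ h ⁻¹' {(p.2 : ℝ)})
    (fun p => (P.measurable p.1).inter (h.measurableSet_preimage _))
    (disjoint_inter P.disjoint (range_disjoint h)) (cover_inter P.cover (range_cover h))
    (summable_simpleSMul h P)

/-- `(f, M)`, i.e. the sequence with `f_0 = f`, `A_0 = M` and `f_i = 0`, `A_i = ∅` for `i ≥ 1`. -/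
def single (f : E.extendedDomain) : PreCotangent E :=
  ofCountable (fun _ : Unit => f) (fun _ => univ) (fun _ => MeasurableSet.univ)
    Subsingleton.pairwise (iUnion_const _) (Summable.of_finite)

theorem val_add (P Q : PreCotangent E) (x : M) : (add P Q).val x = P.val x + Q.val x := by
  obtain ⟨i, hi⟩ := P.exists_mem x
  obtain ⟨j, hj⟩ := Q.exists_mem x
  have h : x ∈ P.A (i, j).1 ∩ Q.A (i, j).2 := ⟨hi, hj⟩
  rw [val_eq P hi, val_eq Q hj]
  exact val_ofCountable (A := fun p : ℕ × ℕ => P.A p.1 ∩ Q.A p.2) h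

theorem val_smul (c : ℝ) (P : PreCotangent E) (x : M) : (smul c P).val x = c • P.val x := by
  obtain ⟨i, hi⟩ := P.exists_mem x
  rw [val_eq P hi, val_eq (smul c P) (show x ∈ (smul c P).A i from hi)]
  rfl

theorem val_single (f : E.extendedDomain) (x : M) : (single f).val x = f :=
  val_ofCountable (i := ()) (mem_univ x)

theorem normSq_add_le (P Q : PreCotangent E) {t : ℝ} (ht : 0 < t) :
    (add P Q).normSq ≤ (1 + t) * P.normSq + (1 + t⁻¹) * Q.normSq := by
  have h := ((P.hasSum_left Q).mul_left (1 + t)).add ((P.hasSum_right Q).mul_left (1 + t⁻¹))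
  have h1 : (add P Q).normSq = _ := normSq_ofCountable
  rw [h1]
  exact hasSum_le (fun p => E.energyOn_add_le _ _ _ ht) (P.summable_add Q).hasSum h

theorem normSq_smul (c : ℝ) (P : PreCotangent E) : (smul c P).normSq = c * c * P.normSq := by
  unfold normSq
  rw [← tsum_mul_left]
  refine tsum_congr fun i => ?_
  simp [smul, mul_assoc]

theorem normSq_nonneg (P : PreCotangent E) : 0 ≤ P.normSq :=
  tsum_nonneg fun _ => E.energyOn_nonneg _ _

theorem Rel.normSq_eq {P Q : PreCotangent E} (h : Rel P Q) : P.normSq = Q.normSq := by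
  refine (P.hasSum_left Q).unique ?_
  refine (P.hasSum_right Q).congr_fun fun p => ?_
  exact E.energyOn_eq_of_sub (h p.1 p.2)

/-- A relation on a countable partition holds as soon as it holds on finer pieces. -/
theorem energyOn_eq_zero_of_inter (R : PreCotangent E) {C : Set M} (hC : MeasurableSet C)
    (f : E.extendedDomain) (h : ∀ k, E.energyOn (C ∩ R.A k) f f = 0) : E.energyOn C f f = 0 := by
  have := VectorMeasure.of_disjoint_iUnion
    (v := E.energyMeasure f f) (f := fun j => C ∩ R.A j)
    (fun j => hC.inter (R.measurable j))
    (fun j k hjk => (R.disjoint hjk).mono inter_subset_right inter_subset_right)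
  rw [← inter_iUnion, R.cover, inter_univ] at this
  rw [energyOn_apply, this]
  exact (tsum_congr h).trans tsum_zero

theorem energyOn_add_eq_zero {C : Set M} {f g : E.extendedDomain} (hf : E.energyOn C f f = 0)
    (hg : E.energyOn C g g = 0) : E.energyOn C (f + g) (f + g) = 0 := by
  refine le_antisymm ?_ (E.energyOn_nonneg _ _)
  simpa [hf, hg] using E.energyOn_add_le C f g one_pos

theorem energyOn_subset_eq_zero {C D : Set M} (hC : MeasurableSet C) (hD : MeasurableSet D)
    (h : C ⊆ D) {f : E.extendedDomain} (hf : E.energyOn D f f = 0) : E.energyOn C f f = 0 :=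
  le_antisymm (hf ▸ E.energyOn_mono hC hD h f) (E.energyOn_nonneg _ _)

theorem Rel.symm {P Q : PreCotangent E} (h : Rel P Q) : Rel Q P := by
  intro i j
  have h1 := h j i
  have h2 : Q.f i - P.f j = -(P.f j - Q.f i) := (neg_sub _ _).symm
  rw [inter_comm, h2]
  simp only [map_neg, LinearMap.neg_apply, neg_neg]
  exact h1

theorem Rel.trans {P Q R : PreCotangent E} (h : Rel P Q) (h' : Rel Q R) : Rel P R := by
  intro i k
  refine energyOn_eq_zero_of_inter Q ((P.measurable i).inter (R.measurable k)) _ fun j => ?_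
  have hm := ((P.measurable i).inter (R.measurable k)).inter (Q.measurable j)
  have h1 := energyOn_subset_eq_zero hm ((P.measurable i).inter (Q.measurable j))
    (fun x hx => ⟨hx.1.1, hx.2⟩) (h i j)
  have h2 := energyOn_subset_eq_zero hm ((Q.measurable j).inter (R.measurable k))
    (fun x hx => ⟨hx.2, hx.1.2⟩) (h' j k)
  have h3 := energyOn_add_eq_zero h1 h2
  rwa [sub_add_sub_cancel] at h3

theorem rel_iff_normSq (P Q : PreCotangent E) : Rel P Q ↔ (add P (smul (-1) Q)).normSq = 0 := by
  have h2 : ∀ p : ℕ × ℕ, P.f p.1 + (smul (-1) Q).f p.2 = P.f p.1 - Q.f p.2 := fun p =>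
    (congrArg (P.f p.1 + ·) (neg_one_smul ℝ (Q.f p.2))).trans (sub_eq_add_neg _ _).symm
  have hs := P.summable_add (smul (-1) Q)
  have h1 : (add P (smul (-1) Q)).normSq = _ := normSq_ofCountable
  simp only [h2] at h1 hs
  change Summable fun p : ℕ × ℕ =>
      E.energyOn (P.A p.1 ∩ Q.A p.2) (P.f p.1 - Q.f p.2) (P.f p.1 - Q.f p.2) at hs
  change _ = ∑' p : ℕ × ℕ,
      E.energyOn (P.A p.1 ∩ Q.A p.2) (P.f p.1 - Q.f p.2) (P.f p.1 - Q.f p.2) at h1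
  have h5 : ∀ p : ℕ × ℕ,
      0 ≤ E.energyOn (P.A p.1 ∩ Q.A p.2) (P.f p.1 - Q.f p.2) (P.f p.1 - Q.f p.2) :=
    fun p => E.energyOn_nonneg _ _
  have h6 : Rel P Q ↔ ∀ p : ℕ × ℕ,
      E.energyOn (P.A p.1 ∩ Q.A p.2) (P.f p.1 - Q.f p.2) (P.f p.1 - Q.f p.2) = 0 :=
    ⟨fun h p => h p.1 p.2, fun h i j => h (i, j)⟩
  rw [h1, h6, ← hs.hasSum_iff, hasSum_zero_iff_of_nonneg h5, funext_iff]
  rfl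

theorem Rel.add {P P' Q Q' : PreCotangent E} (h : Rel P P') (h' : Rel Q Q') :
    Rel (PreCotangent.add P Q) (PreCotangent.add P' Q') := by
  rw [rel_iff_normSq] at h h' ⊢
  have h1 : Rel ((P.add Q).add (PreCotangent.smul (-1) (P'.add Q')))
      ((P.add (PreCotangent.smul (-1) P')).add (Q.add (PreCotangent.smul (-1) Q'))) := by
    refine rel_of_val_eq fun x => ?_
    simp only [val_add, val_smul]
    module
  rw [h1.normSq_eq]
  refine le_antisymm ?_ (normSq_nonneg _)
  simpa [h, h'] using normSq_add_le (PreCotangent.add P (smul (-1) P'))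
    (PreCotangent.add Q (smul (-1) Q')) one_pos

theorem Rel.smul {P P' : PreCotangent E} (c : ℝ) (h : Rel P P') :
    Rel (PreCotangent.smul c P) (PreCotangent.smul c P') := by
  intro i j
  have h1 : E.energyOn (P.A i ∩ P'.A j) (c • P.f i - c • P'.f j) (c • P.f i - c • P'.f j) = 0 := by
    have e : c • P.f i - c • P'.f j = c • (P.f i - P'.f j) := (smul_sub _ _ _).symm
    simp only [e, map_smul, LinearMap.smul_apply, h i j, smul_zero]
  exact h1

/-- The equivalence relation on the pre-cotangent module. -/
instance setoid : Setoid (PreCotangent E) where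
  r := Rel
  iseqv := ⟨fun _ => rel_of_val_eq fun _ => rfl, Rel.symm, Rel.trans⟩

end PreCotangent

/-- The space of equivalence classes `[f_i, A_i]`. -/
def PreCotangentClass : Type _ := Quotient (PreCotangent.setoid (E := E))

namespace PreCotangentClass

variable {E}

/-- The class `[f_i, A_i]`. -/
def mk (P : PreCotangent E) : PreCotangentClass E := Quotient.mk _ P

theorem sound {P Q : PreCotangent E} (h : ∀ x, P.val x = Q.val x) : mk P = mk Q :=
  Quotient.sound (PreCotangent.rel_of_val_eq h)

instance : Add (PreCotangentClass E) :=
  ⟨Quotient.map₂ PreCotangent.add fun _ _ h _ _ h' => PreCotangent.Rel.add h h'⟩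

instance : SMul ℝ (PreCotangentClass E) :=
  ⟨fun c => Quotient.map (PreCotangent.smul c) fun _ _ h => PreCotangent.Rel.smul c h⟩

instance : Zero (PreCotangentClass E) := ⟨mk (PreCotangent.single 0)⟩

instance : Neg (PreCotangentClass E) := ⟨fun v => (-1 : ℝ) • v⟩

theorem mk_add (P Q : PreCotangent E) : mk P + mk Q = mk (P.add Q) := rfl

theorem smul_mk (c : ℝ) (P : PreCotangent E) : c • mk P = mk (P.smul c) := rfl

theorem neg_mk (P : PreCotangent E) : -mk P = mk (P.smul (-1)) := rfl

theorem zero_def : (0 : PreCotangentClass E) = mk (PreCotangent.single 0) := rfl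

theorem ind {p : PreCotangentClass E → Prop} (h : ∀ P, p (mk P)) (v : PreCotangentClass E) : p v :=
  Quotient.ind h v

instance : AddCommGroup (PreCotangentClass E) where
  add_assoc u v w := by
    induction u using ind with | _ P
    induction v using ind with | _ Q
    induction w using ind with | _ R
    simp only [mk_add]
    refine sound fun x => ?_
    simp only [PreCotangent.val_add]
    abel
  zero_add u := by
    induction u using ind with | _ P
    simp only [zero_def, mk_add]
    refine sound fun x => ?_
    simp [PreCotangent.val_add, PreCotangent.val_single]
  add_zero u := by
    induction u using ind with | _ P
    simp only [zero_def, mk_add]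
    refine sound fun x => ?_
    simp [PreCotangent.val_add, PreCotangent.val_single]
  add_comm u v := by
    induction u using ind with | _ P
    induction v using ind with | _ Q
    simp only [mk_add]
    refine sound fun x => ?_
    simp only [PreCotangent.val_add]
    abel
  neg_add_cancel u := by
    induction u using ind with | _ P
    simp only [neg_mk, mk_add, zero_def]
    refine sound fun x => ?_
    simp only [PreCotangent.val_add, PreCotangent.val_single, PreCotangent.val_smul]
    module
  nsmul := nsmulRec
  zsmul := zsmulRec

instance : Module ℝ (PreCotangentClass E) where
  one_smul u := by
    induction u using ind with | _ P
    simp only [smul_mk]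
    exact sound fun x => by simp [PreCotangent.val_smul]
  mul_smul a b u := by
    induction u using ind with | _ P
    simp only [smul_mk]
    exact sound fun x => by simp [PreCotangent.val_smul, mul_smul]
  smul_zero a := by
    simp only [zero_def, smul_mk]
    exact sound fun x => by simp [PreCotangent.val_smul, PreCotangent.val_single]
  smul_add a u v := by
    induction u using ind with | _ P
    induction v using ind with | _ Q
    simp only [smul_mk, mk_add]
    exact sound fun x => by simp [PreCotangent.val_smul, PreCotangent.val_add]
  add_smul a b u := by
    induction u using ind with | _ P
    simp only [smul_mk, mk_add]
    exact sound fun x => by simp [PreCotangent.val_smul, PreCotangent.val_add, add_smul]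
  zero_smul u := by
    induction u using ind with | _ P
    simp only [smul_mk, zero_def]
    exact sound fun x => by simp [PreCotangent.val_smul, PreCotangent.val_single]

/-- `‖[f_i, A_i]‖² = ∑ i, μ_{f_i}[A_i]`. -/
instance : Norm (PreCotangentClass E) :=
  ⟨Quotient.lift (fun P => Real.sqrt P.normSq)
    fun _ _ h => congrArg Real.sqrt (PreCotangent.Rel.normSq_eq h)⟩

theorem norm_mk (P : PreCotangent E) : ‖mk P‖ = Real.sqrt P.normSq := rfl

theorem normCore : NormedSpace.Core ℝ (PreCotangentClass E) where
  norm_nonneg u := by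
    induction u using ind with | _ P
    exact Real.sqrt_nonneg _
  norm_smul c u := by
    induction u using ind with | _ P
    rw [smul_mk, norm_mk, norm_mk, PreCotangent.normSq_smul, Real.sqrt_mul (mul_self_nonneg c),
      Real.sqrt_mul_self_eq_abs, Real.norm_eq_abs]
  norm_triangle u v := by
    induction u using ind with | _ P
    induction v using ind with | _ Q
    rw [mk_add, norm_mk, norm_mk, norm_mk]
    refine le_of_forall_pos_le_add fun ε hε => ?_
    set a := Real.sqrt P.normSq
    set b := Real.sqrt Q.normSq
    have ha : 0 ≤ a := Real.sqrt_nonneg _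
    have hb : 0 ≤ b := Real.sqrt_nonneg _
    have ha2 : P.normSq = a ^ 2 := (Real.sq_sqrt P.normSq_nonneg).symm
    have hb2 : Q.normSq = b ^ 2 := (Real.sq_sqrt Q.normSq_nonneg).symm
    rw [Real.sqrt_le_left (by positivity)]
    have h := PreCotangent.normSq_add_le P Q (t := (b + ε / 2) / (a + ε / 2)) (by positivity)
    have h1 : (1 + (b + ε / 2) / (a + ε / 2)) * (a + ε / 2) ^ 2
        + (1 + ((b + ε / 2) / (a + ε / 2))⁻¹) * (b + ε / 2) ^ 2 = (a + b + ε) ^ 2 := by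
      field_simp
      ring
    rw [← h1]
    refine h.trans (add_le_add ?_ ?_)
    · rw [ha2]
      gcongr
      linarith
    · rw [hb2]
      gcongr
      linarith
  norm_eq_zero_iff u := by
    induction u using ind with | _ P
    rw [norm_mk, Real.sqrt_eq_zero P.normSq_nonneg]
    have h0 : (P.add ((PreCotangent.single (0 : E.extendedDomain)).smul (-1))).normSq
        = P.normSq := by
      refine PreCotangent.Rel.normSq_eq (PreCotangent.rel_of_val_eq fun x => ?_)
      simp [PreCotangent.val_add, PreCotangent.val_smul, PreCotangent.val_single]
    rw [← h0, ← PreCotangent.rel_iff_normSq]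
    exact ⟨fun h => Quotient.sound h, fun h => Quotient.exact h⟩

instance : NormedAddCommGroup (PreCotangentClass E) := NormedAddCommGroup.ofCore normCore

instance : NormedSpace ℝ (PreCotangentClass E) := NormedSpace.ofCore normCore

end PreCotangentClass

/-- The cotangent module `L²(T*M)`: the completion of the space of classes `[f_i, A_i]`. -/
abbrev CotangentModule : Type _ := UniformSpace.Completion (PreCotangentClass E)

/-- The class `[f_i, A_i]` as an element of the cotangent module. -/
def toCotangent (P : PreCotangent E) : E.CotangentModule :=
  ((PreCotangentClass.mk P : PreCotangentClass E) : UniformSpace.Completion (PreCotangentClass E))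

/-- The differential `d f = [f, M]`. -/
def differential (f : E.extendedDomain) : E.CotangentModule :=
  E.toCotangent (PreCotangent.single f)

end Cotangent

end DirichletForm

section Modules

variable {M : Type*} [MeasurableSpace M]

/-- The structure (multiplication and pointwise norm) of an `L^p`-normed `L^∞`-module with respect to `μ` on the real Banach space `V`:
a bilinear multiplication `L^∞(M, μ) × V → V` with `(f g) v = f (g v)` and `1 v = v`, and a
nonnegative pointwise norm `|·| : V → L^p(M, μ)` with `|f v| = |f| |v|` and `‖v‖ = ‖|v|‖_{L^p}`. -/
structure NormedLinftyModule (μ : Measure M) (p : ℝ≥0∞) (V : Type*) [NormedAddCommGroup V]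
    [NormedSpace ℝ V] where
  complete : CompleteSpace V
  smul : Lp ℝ ∞ μ →ₗ[ℝ] V →ₗ[ℝ] V
  mul_smul : ∀ (f g fg : Lp ℝ ∞ μ) (v : V),
    (fg : M →ₘ[μ] ℝ) = (f : M →ₘ[μ] ℝ) * (g : M →ₘ[μ] ℝ) → smul fg v = smul f (smul g v)
  one_smul : ∀ (e : Lp ℝ ∞ μ) (v : V), (e : M →ₘ[μ] ℝ) = 1 → smul e v = v
  pnorm : V → Lp ℝ p μ
  pnorm_nonneg : ∀ v, 0 ≤ (pnorm v : M →ₘ[μ] ℝ)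
  pnorm_smul : ∀ (f : Lp ℝ ∞ μ) (v : V),
    (pnorm (smul f v) : M →ₘ[μ] ℝ) = |(f : M →ₘ[μ] ℝ)| * (pnorm v : M →ₘ[μ] ℝ)
  norm_eq : ∀ v, ‖v‖ = ‖pnorm v‖

namespace NormedLinftyModule

variable {μ : Measure M} {p : ℝ≥0∞} {V : Type*} [NormedAddCommGroup V] [NormedSpace ℝ V]

theorem mul_add' (f g h : M →ₘ[μ] ℝ) : f * (g + h) = f * g + f * h := by
  refine AEEqFun.ext ?_
  filter_upwards [AEEqFun.coeFn_mul f (g + h), AEEqFun.coeFn_add g h,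
    AEEqFun.coeFn_add (f * g) (f * h), AEEqFun.coeFn_mul f g, AEEqFun.coeFn_mul f h]
    with x h1 h2 h3 h4 h5
  simp only [h1, h2, h3, h4, h5, Pi.mul_apply, Pi.add_apply]
  ring

theorem mul_zero' (f : M →ₘ[μ] ℝ) : f * 0 = 0 := by
  refine AEEqFun.ext ?_
  filter_upwards [AEEqFun.coeFn_mul f 0, AEEqFun.coeFn_zero (μ := μ) (β := ℝ) (α := M)]
    with x h1 h2
  simp [h1, h2]

theorem mul_smul' (c : ℝ) (f g : M →ₘ[μ] ℝ) : f * (c • g) = c • (f * g) := by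
  refine AEEqFun.ext ?_
  filter_upwards [AEEqFun.coeFn_mul f (c • g), AEEqFun.coeFn_smul c g,
    AEEqFun.coeFn_smul c (f * g), AEEqFun.coeFn_mul f g] with x h1 h2 h3 h4
  simp only [h1, h2, h3, h4, Pi.mul_apply, Pi.smul_apply, smul_eq_mul]
  ring

/-- The dual module `Hom(V; L¹(M, μ))` of all bounded linear maps `L : V → L¹(M, μ)` with
`L (f v) = f L(v)` for `f` in `L^∞(M, μ)`, with the operator norm. -/
def Dual (S : NormedLinftyModule μ p V) : Submodule ℝ (V →L[ℝ] Lp ℝ 1 μ) where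
  carrier := {L | ∀ (f : Lp ℝ ∞ μ) (v : V),
    (L (S.smul f v) : M →ₘ[μ] ℝ) = (f : M →ₘ[μ] ℝ) * (L v : M →ₘ[μ] ℝ)}
  add_mem' := fun h h' f v =>
    (congrArg₂ (· + ·) (h f v) (h' f v)).trans (mul_add' _ _ _).symm
  zero_mem' := fun _ _ => (mul_zero' _).symm
  smul_mem' := fun c _ h f v =>
    (congrArg (c • ·) (h f v)).trans (mul_smul' _ _ _).symm

/-- Multiplication of the dual module and its pointwise norm are the natural ones:
`(f L)(v) = f L(v)`, and `|L|` is the essential supremum of all `|L(v)|` with `|v| ≤ 1` a.e. -/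
def IsDualStructure {q : ℝ≥0∞} (S : NormedLinftyModule μ p V)
    (T : NormedLinftyModule μ q S.Dual) : Prop :=
  (∀ (f : Lp ℝ ∞ μ) (L : S.Dual) (v : V),
    ((T.smul f L : V →L[ℝ] Lp ℝ 1 μ) v : M →ₘ[μ] ℝ)
      = (f : M →ₘ[μ] ℝ) * ((L : V →L[ℝ] Lp ℝ 1 μ) v : M →ₘ[μ] ℝ)) ∧
  ∀ L : S.Dual, IsLUB
    {u : M →ₘ[μ] ℝ | ∃ v : V, (S.pnorm v : M →ₘ[μ] ℝ) ≤ 1 ∧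
      u = |((L : V →L[ℝ] Lp ℝ 1 μ) v : M →ₘ[μ] ℝ)|}
    (T.pnorm L : M →ₘ[μ] ℝ)

/-- `S`, an `L²`-normed `L^∞`-module, is a Hilbert module: its norm comes from a scalar product
(completeness is part of `S`). -/
def IsHilbertModule (_S : NormedLinftyModule μ 2 V) : Prop :=
  ∃ B : LinearMap.BilinForm ℝ V, (∀ v w, B v w = B w v) ∧ ∀ v, B v v = ‖v‖ ^ 2

/-- The pointwise scalar product `⟨v, w⟩ = (|v + w|² - |v - w|²) / 4`, by polarization. -/
def pinner (S : NormedLinftyModule μ 2 V) (v w : V) : M → ℝ :=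
  fun x => (S.pnorm (v + w) x ^ 2 - S.pnorm (v - w) x ^ 2) / 4

/-- The musical isomorphism: the element `L = v♯` of the dual module is the one with
`L(w) = ⟨v, w⟩` a.e. for every `w`. -/
def IsSharp (S : NormedLinftyModule μ 2 V) (v : V) (L : S.Dual) : Prop :=
  ∀ w, (L : V →L[ℝ] Lp ℝ 1 μ) w =ᵐ[μ] S.pinner v w

end NormedLinftyModule

end Modules

end

/-! The pointwise scalar product of $[f_i,A_i]$ and $[g_j,B_j]$ should be $\Gamma_\mu(f_i,g_j)$ on
$A_i\cap B_j$ (`gamma`). Since $\boldsymbol\mu_{f,g}\ll\mu$ on all of $\mathcal F_e$, integrals of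
$\Gamma_\mu$ over sets recover the energy measures. Hence `gamma` is a.e. bilinear, symmetric,
nonnegative on the diagonal, and integrates there to the squared norm. Cauchy-Schwarz makes it
independent of representatives and bounded into $L^1(\mu)$, so it extends to the completion, where
its integral is a scalar product inducing the given norm.

The rest is a statement about any Hilbert space $H$ with an $L^1(\mu)$-valued scalar product
$\langle\cdot,\cdot\rangle$ of this kind (`PointwiseInner`). The product $fv$ is the Riesz
representative of $w\mapsto\int f\langle v,w\rangle\,d\mu$, and $|v|=\langle v,v\rangle^{1/2}$.
Riesz alone gives only an integrated identity; the pointwise one, $\langle fv,w\rangle=f\langle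
v,w\rangle$ (`toCLM_smul`), follows because indicators can be moved from one slot to the other,
which is checked on the dense set of classes $[f_i,A_i]$.

For the dual, $v\mapsto\langle v,\cdot\rangle$ is an isometry by Cauchy-Schwarz. It is onto
(`sharp_surjective`): the Riesz vector of $w\mapsto\int L(w)\,d\mu$ represents $L$ on every
measurable set, by $L^\infty$-linearity. The module structure of $H$ is then transported to the
dual, and the gradient is the differential followed by this isometry. -/

/-! ### Two Cauchy-Schwarz inequalities. -/

/-- A pointwise a.e. Cauchy-Schwarz inequality for the coefficients of a quadratic polynomial that is
nonnegative a.e. for each argument. -/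
theorem ae_sq_le_mul_of_forall_ae_nonneg {M : Type*} [MeasurableSpace M] {μ : Measure M}
    {a b c : M → ℝ} (h : ∀ t : ℝ, ∀ᵐ x ∂μ, 0 ≤ a x + 2 * t * b x + t * t * c x) :
    ∀ᵐ x ∂μ, b x ^ 2 ≤ a x * c x := by
  -- The null set in `h` depends on `t`; rational `t` give a common one, and continuity in `t`
  -- recovers the reals.
  have hq : ∀ᵐ x ∂μ, ∀ t : ℚ, 0 ≤ a x + 2 * (t : ℝ) * b x + t * t * c x :=
    ae_all_iff.2 fun t => h t
  filter_upwards [hq] with x hx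
  have hr : ∀ t : ℝ, 0 ≤ a x + 2 * t * b x + t * t * c x := fun t =>
    Rat.denseRange_cast.induction_on t
      (isClosed_le continuous_const (by fun_prop)) hx
  have hd := discrim_le_zero (a := c x) (b := 2 * b x) (c := a x) fun t => by
    have := hr t
    linarith
  rw [discrim] at hd
  linarith

/-- The integrated form of a pointwise Cauchy-Schwarz inequality. -/
theorem integral_abs_le_sqrt_mul_sqrt {M : Type*} [MeasurableSpace M] {μ : Measure M}
    {a b c : M → ℝ} (ha : Integrable a μ) (hb : Integrable b μ) (hc : Integrable c μ)
    (ha0 : 0 ≤ᵐ[μ] a) (hc0 : 0 ≤ᵐ[μ] c) (h : ∀ᵐ x ∂μ, b x ^ 2 ≤ a x * c x) :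
    ∫ x, |b x| ∂μ ≤ √(∫ x, a x ∂μ) * √(∫ x, c x ∂μ) := by
  rw [← Real.sqrt_mul (integral_nonneg_of_ae ha0)]
  refine Real.le_sqrt_of_sq_le ?_
  have hd := discrim_le_zero (a := ∫ x, c x ∂μ) (b := -2 * ∫ x, |b x| ∂μ) (c := ∫ x, a x ∂μ)
    fun t => by
      have h1 : 0 ≤ ∫ x, (c x * (t * t) + -2 * |b x| * t) + a x ∂μ := by
        refine integral_nonneg_of_ae ?_
        filter_upwards [ha0, hc0, h] with x h2 h3 h4
        simp only [Pi.zero_apply] at h2 h3 ⊢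
        -- Squares are compared: $4b^2t^2\le 4act^2\le(ct^2+a)^2$.
        have h5 : 2 * |b x| * t ≤ c x * (t * t) + a x := by
          refine (le_abs_self _).trans (abs_le_of_sq_le_sq ?_
            (add_nonneg (mul_nonneg h3 (mul_self_nonneg t)) h2))
          rw [mul_pow, mul_pow, sq_abs]
          nlinarith [mul_le_mul_of_nonneg_left h4 (sq_nonneg t),
            sq_nonneg (c x * (t * t) - a x)]
        linarith
      have i1 : Integrable (fun x => c x * (t * t)) μ := hc.mul_const _
      have i2 : Integrable (fun x => -2 * |b x| * t) μ := (hb.abs.const_mul _).mul_const _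
      have i3 : Integrable (fun x => c x * (t * t) + -2 * |b x| * t) μ := i1.add i2
      rwa [integral_add i3 ha, integral_add i1 i2, integral_mul_const, integral_mul_const,
        integral_const_mul] at h1
  rw [discrim] at hd
  linarith

/-! ### Hilbert spaces with a pointwise scalar product, as modules over $L^\infty$. -/

/-- A pointwise scalar product on a Hilbert space `H` with values in `L¹(M, μ)`: a symmetric
bilinear map, nonnegative on the diagonal, that integrates to the scalar product of `H` and such
that the elements of a dense subset can be multiplied by indicator functions. -/
structure PointwiseInner {M : Type*} [MeasurableSpace M] (μ : Measure M) (H : Type*)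
    [NormedAddCommGroup H] [InnerProductSpace ℝ H] where
  toCLM : H →L[ℝ] H →L[ℝ] Lp ℝ 1 μ
  symm : ∀ v w, toCLM v w = toCLM w v
  nonneg : ∀ v, 0 ≤ᵐ[μ] toCLM v v
  integral_eq : ∀ v w, ∫ x, toCLM v w x ∂μ = inner ℝ v w
  -- Only a dense set is asked for, since cutting off by an indicator is explicit only on the
  -- classes $[f_i,A_i]$.
  exists_indicator : ∃ D : Set H, Dense D ∧ ∀ (A : Set M), MeasurableSet A → ∀ v ∈ D,
    ∃ v', ∀ w ∈ D, toCLM v' w =ᵐ[μ] A.indicator (toCLM v w)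

namespace PointwiseInner

variable {M : Type*} [MeasurableSpace M] {μ : Measure M} {H : Type*}
  [NormedAddCommGroup H] [InnerProductSpace ℝ H] (G : PointwiseInner μ H)

theorem ae_sq_le (v w : H) : ∀ᵐ x ∂μ, G.toCLM v w x ^ 2 ≤ G.toCLM v v x * G.toCLM w w x := by
  refine ae_sq_le_mul_of_forall_ae_nonneg fun t => ?_
  have h : G.toCLM (v + t • w) (v + t • w)
      = G.toCLM v v + ((2 * t) • G.toCLM v w + (t * t) • G.toCLM w w) := by
    simp only [map_add, map_smul, _root_.add_apply, _root_.smul_apply,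
      G.symm w v]
    module
  have h0 := G.nonneg (v + t • w)
  rw [h] at h0
  filter_upwards [h0, Lp.coeFn_add (G.toCLM v v) ((2 * t) • G.toCLM v w + (t * t) • G.toCLM w w),
    Lp.coeFn_add ((2 * t) • G.toCLM v w) ((t * t) • G.toCLM w w),
    Lp.coeFn_smul (2 * t) (G.toCLM v w), Lp.coeFn_smul (t * t) (G.toCLM w w)] with x h1 h2 h3 h4 h5
  simp only [h2, h3, h4, h5, Pi.add_apply, Pi.smul_apply, smul_eq_mul, Pi.zero_apply] at h1
  linarith

theorem memLp_sqrt (v : H) : MemLp (fun x => √(G.toCLM v v x)) 2 μ := by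
  have hm := (Lp.aestronglyMeasurable (G.toCLM v v))
  rw [memLp_two_iff_integrable_sq (hm.aemeasurable.sqrt.aestronglyMeasurable)]
  refine (L1.integrable_coeFn (G.toCLM v v)).congr ?_
  filter_upwards [G.nonneg v] with x hx
  exact (Real.sq_sqrt hx).symm

/-- The pointwise norm `|v| = ⟨v, v⟩^{1/2}`. -/
noncomputable def pnorm (v : H) : Lp ℝ 2 μ := (G.memLp_sqrt v).toLp

theorem coeFn_pnorm (v : H) : G.pnorm v =ᵐ[μ] fun x => √(G.toCLM v v x) := MemLp.coeFn_toLp _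

theorem pnorm_nonneg (v : H) : 0 ≤ᵐ[μ] G.pnorm v := by
  filter_upwards [G.coeFn_pnorm v] with x hx
  rw [hx]
  exact Real.sqrt_nonneg _

theorem pnorm_sq (v : H) : ∀ᵐ x ∂μ, G.pnorm v x ^ 2 = G.toCLM v v x := by
  filter_upwards [G.coeFn_pnorm v, G.nonneg v] with x hx h0
  rw [hx, Real.sq_sqrt h0]

theorem ae_abs_le (v w : H) : ∀ᵐ x ∂μ, |G.toCLM v w x| ≤ G.pnorm v x * G.pnorm w x := by
  filter_upwards [G.ae_sq_le v w, G.pnorm_sq v, G.pnorm_sq w, G.pnorm_nonneg v, G.pnorm_nonneg w]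
    with x h hv hw hv0 hw0
  refine abs_le_of_sq_le_sq ?_ (mul_nonneg hv0 hw0)
  rw [mul_pow, hv, hw]
  exact h

theorem norm_pnorm (v : H) : ‖G.pnorm v‖ = ‖v‖ := by
  have h : ‖G.pnorm v‖ ^ 2 = ‖v‖ ^ 2 := by
    rw [← real_inner_self_eq_norm_sq, ← real_inner_self_eq_norm_sq, ← G.integral_eq, L2.inner_def]
    refine integral_congr_ae ?_
    filter_upwards [G.pnorm_sq v] with x hx
    rw [← hx, real_inner_self_eq_norm_sq, Real.norm_eq_abs, sq_abs]
  exact (sq_eq_sq₀ (norm_nonneg _) (norm_nonneg _)).1 h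

theorem norm_apply_le (v w : H) : ‖G.toCLM v w‖ ≤ ‖v‖ * ‖w‖ := by
  have h := integral_abs_le_sqrt_mul_sqrt (L1.integrable_coeFn _) (L1.integrable_coeFn _)
    (L1.integrable_coeFn _) (G.nonneg v) (G.nonneg w) (G.ae_sq_le v w)
  rw [G.integral_eq, G.integral_eq, ← norm_eq_sqrt_real_inner, ← norm_eq_sqrt_real_inner] at h
  rwa [L1.norm_eq_integral_norm]

theorem norm_apply_self (v : H) : ‖G.toCLM v v‖ = ‖v‖ * ‖v‖ := by
  rw [L1.norm_eq_integral_norm, ← real_inner_self_eq_norm_mul_norm, ← G.integral_eq]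
  refine integral_congr_ae ?_
  filter_upwards [G.nonneg v] with x hx
  exact Real.norm_of_nonneg hx

/-- Cauchy-Schwarz bounds the operator norm, and the bound is attained at `v` itself. -/
theorem norm_toCLM (v : H) : ‖G.toCLM v‖ = ‖v‖ := by
  refine le_antisymm ((G.toCLM v).opNorm_le_bound (norm_nonneg _) (G.norm_apply_le v)) ?_
  rcases (norm_nonneg v).eq_or_lt with h | h
  · rw [← h]
    exact norm_nonneg _
  · refine le_of_mul_le_mul_right ?_ h
    rw [← G.norm_apply_self]
    exact (G.toCLM v).le_opNorm v

/-- Two elements of `L¹` are equal if their integrals over all measurable sets are. -/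
theorem _root_.MeasureTheory.L1.ext_setIntegral {u u' : Lp ℝ 1 μ}
    (h : ∀ A, MeasurableSet A → ∫ x in A, u x ∂μ = ∫ x in A, u' x ∂μ) : u = u' :=
  Lp.ext ((L1.integrable_coeFn u).ae_eq_of_forall_setIntegral_eq u u' (L1.integrable_coeFn u')
    fun A hA _ => h A hA)

theorem _root_.NormedLinftyModule.isHilbertModule (S : NormedLinftyModule μ 2 H) : S.IsHilbertModule :=
  ⟨innerₗ H, fun v w => real_inner_comm w v, fun v => real_inner_self_eq_norm_sq v⟩

variable [CompleteSpace H]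

/-- The product of `f ∈ L^∞` and `v ∈ H`, characterised by `⟪f v, w⟫ = ∫ f ⟨v, w⟩`. -/
noncomputable def smul : Lp ℝ ∞ μ →ₗ[ℝ] H →ₗ[ℝ] H :=
  LinearMap.mk₂ ℝ (fun f v => (InnerProductSpace.toDual ℝ H).symm
      (((ContinuousLinearMap.mul ℝ ℝ).lpPairing μ ∞ 1 f).comp (G.toCLM v)))
    (fun f g v => by rw [map_add, ContinuousLinearMap.add_comp, map_add])
    (fun c f v => by rw [map_smul, ContinuousLinearMap.smul_comp, map_smulₛₗ]; simp)
    (fun f v w => by rw [map_add, ContinuousLinearMap.comp_add, map_add])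
    (fun c f v => by rw [map_smul, ContinuousLinearMap.comp_smul, map_smulₛₗ]; simp)

theorem inner_smul (f : Lp ℝ ∞ μ) (v w : H) :
    inner ℝ (G.smul f v) w = ∫ x, f x * G.toCLM v w x ∂μ := by
  simp only [smul, LinearMap.mk₂_apply, InnerProductSpace.toDual_symm_apply,
    ContinuousLinearMap.comp_apply, ContinuousLinearMap.lpPairing_eq_integral,
    ContinuousLinearMap.mul_apply']

/-- A vector is determined by its scalar products with a dense set, so a candidate for the Riesz
product need only be tested there. The module laws and the compatibility with simple functions are
proved in this way. -/
theorem smul_eq_of_forall {f : Lp ℝ ∞ μ} {v v' : H} {D : Set H} (hD : Dense D)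
    (h : ∀ w ∈ D, G.toCLM v' w =ᵐ[μ] fun x => f x * G.toCLM v w x) : G.smul f v = v' := by
  refine hD.eq_of_inner_left (𝕜 := ℝ) fun w hw => ?_
  rw [inner_smul, ← G.integral_eq]
  exact (integral_congr_ae (h w hw)).symm

theorem continuous_smul (f : Lp ℝ ∞ μ) : Continuous (G.smul f) :=
  (InnerProductSpace.toDual ℝ H).symm.continuous.comp
    ((ContinuousLinearMap.compL ℝ H (Lp ℝ 1 μ) ℝ
      ((ContinuousLinearMap.mul ℝ ℝ).lpPairing μ ∞ 1 f)).continuous.comp G.toCLM.continuous)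

/-- For `v ∈ D` the cut-off vector supplied by `exists_indicator` must be the Riesz product.
Multiplication by `g` is continuous on $L^1$, so the identity passes from `D` to `H` by density, in
`w` and then in `v`. -/
theorem toCLM_indicator {A : Set M} (hA : MeasurableSet A) {g : Lp ℝ ∞ μ}
    (hg : g =ᵐ[μ] A.indicator 1) (v w : H) :
    G.toCLM (G.smul g v) w =ᵐ[μ] A.indicator (G.toCLM v w) := by
  obtain ⟨D, hD, h⟩ := G.exists_indicator
  set m := (ContinuousLinearMap.mul ℝ ℝ).holderL μ ∞ 1 1 g
  have hm : ∀ u : Lp ℝ 1 μ, m u =ᵐ[μ] A.indicator u := fun u => by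
    filter_upwards [(ContinuousLinearMap.mul ℝ ℝ).coeFn_holder (r := 1) g u, hg] with x h1 h2
    refine h1.trans ?_
    by_cases hx : x ∈ A <;> simp [h2, hx]
  have h1 : ∀ v ∈ D, ∀ w ∈ D, G.toCLM (G.smul g v) w = m (G.toCLM v w) := by
    intro v hv w hw
    obtain ⟨v', hv'⟩ := h A hA v hv
    rw [G.smul_eq_of_forall hD (v' := v') fun w hw => ?_]
    · exact Lp.ext ((hv' w hw).trans (hm _).symm)
    · filter_upwards [hv' w hw, hg] with x h1 h2
      by_cases hx : x ∈ A <;> simp [h1, h2, hx]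
  have h2 : ∀ v ∈ D, ∀ w, G.toCLM (G.smul g v) w = m (G.toCLM v w) := fun v hv =>
    congrFun (Continuous.ext_on hD (ContinuousLinearMap.continuous _)
      (m.continuous.comp (ContinuousLinearMap.continuous _)) (h1 v hv))
  have h3 : (fun v => G.toCLM (G.smul g v) w) = fun v => m (G.toCLM v w) :=
    Continuous.ext_on hD
      ((G.toCLM.continuous.comp (G.continuous_smul g)).clm_apply continuous_const)
      (m.continuous.comp (G.toCLM.continuous.clm_apply continuous_const)) fun v hv => h2 v hv w
  rw [congrFun h3 v]
  exact hm _

theorem _root_.MeasureTheory.Lp.exists_coeFn_eq_indicator {A : Set M} (hA : MeasurableSet A) :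
    ∃ g : Lp ℝ ∞ μ, g =ᵐ[μ] A.indicator 1 :=
  ⟨MemLp.toLp (A.indicator 1) ((memLp_top_const 1).indicator hA), MemLp.coeFn_toLp _⟩

/-- Integrate over a measurable `A`: the indicator moves into the second slot, $\int_A\langle
fv,w\rangle=\langle\!\langle fv,1_Aw\rangle\!\rangle=\int f\langle v,1_Aw\rangle=\int_A f\langle
v,w\rangle$, with $\langle\!\langle\cdot,\cdot\rangle\!\rangle$ the scalar product of `H`. -/
theorem toCLM_smul (f : Lp ℝ ∞ μ) (v w : H) :
    G.toCLM (G.smul f v) w =ᵐ[μ] fun x => f x * G.toCLM v w x := by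
  have h : G.toCLM (G.smul f v) w = (f • G.toCLM v w : Lp ℝ 1 μ) := by
    refine L1.ext_setIntegral fun A hA => ?_
    obtain ⟨g, hg⟩ := Lp.exists_coeFn_eq_indicator (μ := μ) hA
    have hw' := G.toCLM_indicator hA hg w
    have h1 : ∫ x in A, G.toCLM (G.smul f v) w x ∂μ = inner ℝ (G.smul f v) (G.smul g w) := by
      rw [← integral_indicator hA, ← G.integral_eq, G.symm, G.symm _ (G.smul g w)]
      exact (integral_congr_ae (hw' _)).symm
    rw [h1, inner_smul, ← integral_indicator hA]
    refine integral_congr_ae ?_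
    filter_upwards [hw' v, Lp.coeFn_lpSMul (r := 1) f (G.toCLM v w)] with x h2 h3
    rw [G.symm v (G.smul g w), h2, G.symm w v]
    by_cases hx : x ∈ A <;> simp [hx, h3]
  rw [h]
  exact Lp.coeFn_lpSMul (r := 1) f (G.toCLM v w)

theorem pnorm_smul (f : Lp ℝ ∞ μ) (v : H) :
    G.pnorm (G.smul f v) =ᵐ[μ] fun x => |f x| * G.pnorm v x := by
  filter_upwards [G.coeFn_pnorm v, G.coeFn_pnorm (G.smul f v), G.toCLM_smul f v (G.smul f v),
    G.toCLM_smul f v v] with x h1 h2 h3 h4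
  rw [h1, h2, h3, G.symm, h4, ← mul_assoc, Real.sqrt_mul (mul_self_nonneg _),
    Real.sqrt_mul_self_eq_abs]

/-- A Hilbert space with a pointwise scalar product is an `L²`-normed `L^∞`-module. -/
noncomputable def linftyModule : NormedLinftyModule μ 2 H where
  complete := inferInstance
  smul := G.smul
  mul_smul f g fg v hfg := by
    refine G.smul_eq_of_forall dense_univ fun w _ => ?_
    have h : (fg : M →ₘ[μ] ℝ) =ᵐ[μ] fun x => f x * g x := by
      rw [hfg]
      exact AEEqFun.coeFn_mul _ _
    filter_upwards [h, G.toCLM_smul f (G.smul g v) w, G.toCLM_smul g v w] with x h1 h2 h3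
    rw [h1, h2, h3, mul_assoc]
  one_smul e v he := by
    refine G.smul_eq_of_forall dense_univ fun w _ => ?_
    have h : (e : M →ₘ[μ] ℝ) =ᵐ[μ] fun _ => 1 := by
      rw [he]
      exact AEEqFun.coeFn_one
    filter_upwards [h] with x h1
    rw [h1, one_mul]
  pnorm := G.pnorm
  pnorm_nonneg v := by
    rw [← AEEqFun.coeFn_le]
    filter_upwards [G.pnorm_nonneg v, AEEqFun.coeFn_zero (μ := μ) (β := ℝ) (α := M)] with x h1 h2
    rw [h2]
    exact h1
  pnorm_smul f v := by
    refine AEEqFun.ext ?_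
    filter_upwards [G.pnorm_smul f v, AEEqFun.coeFn_mul |(f : M →ₘ[μ] ℝ)| (G.pnorm v : M →ₘ[μ] ℝ),
      AEEqFun.coeFn_abs (f : M →ₘ[μ] ℝ)] with x h1 h2 h3
    rw [h1, h2, Pi.mul_apply, h3]
  norm_eq v := (G.norm_pnorm v).symm

theorem pinner_eq (v w : H) : G.toCLM v w =ᵐ[μ] G.linftyModule.pinner v w := by
  have h : (4 : ℝ) • G.toCLM v w = G.toCLM (v + w) (v + w) - G.toCLM (v - w) (v - w) := by
    simp only [map_add, map_sub, _root_.add_apply, _root_.sub_apply,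
      G.symm w v]
    module
  filter_upwards [Lp.coeFn_smul (4 : ℝ) (G.toCLM v w),
    Lp.coeFn_sub (G.toCLM (v + w) (v + w)) (G.toCLM (v - w) (v - w)), G.pnorm_sq (v + w),
    G.pnorm_sq (v - w)] with x h1 h2 h3 h4
  rw [h, h2] at h1
  simp only [Pi.sub_apply, Pi.smul_apply, smul_eq_mul] at h1
  change _ = (G.pnorm (v + w) x ^ 2 - G.pnorm (v - w) x ^ 2) / 4
  rw [h3, h4]
  linarith

/-! ### The dual module and the musical isomorphism. -/

/-- The musical isomorphism `v ↦ ⟨v, ·⟩` onto the dual module. -/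
noncomputable def sharp : H →ₗ[ℝ] G.linftyModule.Dual :=
  (G.toCLM : H →ₗ[ℝ] H →L[ℝ] Lp ℝ 1 μ).codRestrict _ fun v f w => by
    refine AEEqFun.ext ?_
    filter_upwards [G.toCLM_smul f w v, AEEqFun.coeFn_mul (f : M →ₘ[μ] ℝ)
      (G.toCLM v w : M →ₘ[μ] ℝ)] with x h1 h2
    rw [G.symm] at h1
    rw [G.symm w v] at h1
    exact h1.trans h2.symm

theorem coe_sharp (v : H) : (G.sharp v : H →L[ℝ] Lp ℝ 1 μ) = G.toCLM v := rfl

theorem isSharp (v : H) : G.linftyModule.IsSharp v (G.sharp v) := fun w => G.pinner_eq v w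

theorem norm_sharp (v : H) : ‖G.sharp v‖ = ‖v‖ := G.norm_toCLM v

/-- Let $v$ be the Riesz vector of $w\mapsto\int L(w)\,d\mu$. Inserting $1_Aw$ and using
$L(1_Aw)=1_AL(w)$ gives $\int_AL(w)=\int_A\langle v,w\rangle$ for every measurable $A$. -/
theorem sharp_surjective : Function.Surjective G.sharp := by
  intro L
  set φ : StrongDual ℝ H := (L1.integralCLM (α := M) (E := ℝ) (μ := μ)).comp
    (L : H →L[ℝ] Lp ℝ 1 μ) with hφ
  have hφ' : ∀ w, ∫ x, (L : H →L[ℝ] Lp ℝ 1 μ) w x ∂μ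
      = inner ℝ ((InnerProductSpace.toDual ℝ H).symm φ) w := by
    intro w
    rw [InnerProductSpace.toDual_symm_apply, hφ, ContinuousLinearMap.comp_apply,
      ← L1.integral_eq, L1.integral_eq_integral]
  refine ⟨(InnerProductSpace.toDual ℝ H).symm φ, Subtype.ext (ContinuousLinearMap.ext fun w => ?_)⟩
  rw [coe_sharp]
  refine L1.ext_setIntegral fun A hA => ?_
  obtain ⟨g, hg⟩ := Lp.exists_coeFn_eq_indicator (μ := μ) hA
  have h1 := hφ' (G.smul g w)
  rw [← G.integral_eq] at h1
  rw [← integral_indicator hA, ← integral_indicator hA]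
  have h2 : (L : H →L[ℝ] Lp ℝ 1 μ) (G.smul g w)
      =ᵐ[μ] A.indicator ((L : H →L[ℝ] Lp ℝ 1 μ) w) := by
    have h3 := L.2 g w
    filter_upwards [hg, AEEqFun.coeFn_mul (g : M →ₘ[μ] ℝ)
      ((L : H →L[ℝ] Lp ℝ 1 μ) w : M →ₘ[μ] ℝ)] with x h4 h5
    have h6 := (congrFun (congrArg _ h3) x).trans h5
    refine h6.trans ?_
    rw [Pi.mul_apply, h4]
    by_cases hx : x ∈ A <;> simp [hx]
  rw [← integral_congr_ae h2, h1]
  refine integral_congr_ae ?_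
  filter_upwards [hg, G.toCLM_smul g w ((InnerProductSpace.toDual ℝ H).symm φ)] with x h4 h5
  rw [G.symm _ (G.smul g w), h5, h4, G.symm w]
  by_cases hx : x ∈ A <;> simp [hx]

/-- The musical isomorphism as an isometry onto the dual module. -/
noncomputable def sharpEquiv : H ≃ₗᵢ[ℝ] G.linftyModule.Dual :=
  LinearIsometryEquiv.ofSurjective ⟨G.sharp, G.norm_sharp⟩ G.sharp_surjective

theorem sharpEquiv_apply (v : H) : G.sharpEquiv v = G.sharp v := rfl

end PointwiseInner

/-- Transport of the structure of a normed module along a linear isometry. -/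
noncomputable def NormedLinftyModule.congr {M : Type*} [MeasurableSpace M] {μ : Measure M}
    {p : ℝ≥0∞} {V W : Type*} [NormedAddCommGroup V] [NormedSpace ℝ V] [NormedAddCommGroup W]
    [NormedSpace ℝ W] (S : NormedLinftyModule μ p V) (e : V ≃ₗᵢ[ℝ] W) :
    NormedLinftyModule μ p W where
  complete := e.symm.toIsometryEquiv.completeSpace_iff.2 S.complete
  smul := LinearMap.mk₂ ℝ (fun f w => e (S.smul f (e.symm w)))
    (fun f g w => by simp) (fun c f w => by simp) (fun f v w => by simp) (fun c f w => by simp)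
  mul_smul f g fg v h := by simp [S.mul_smul f g fg _ h]
  one_smul f v h := by simp [S.one_smul f _ h]
  pnorm w := S.pnorm (e.symm w)
  pnorm_nonneg w := S.pnorm_nonneg _
  pnorm_smul f w := by simp [S.pnorm_smul]
  norm_eq w := by rw [← S.norm_eq, e.symm.norm_map]

namespace PointwiseInner

variable {M : Type*} [MeasurableSpace M] {μ : Measure M} {H : Type*}
  [NormedAddCommGroup H] [InnerProductSpace ℝ H] [CompleteSpace H] (G : PointwiseInner μ H)

/-- The upper bound is Cauchy-Schwarz. Minimality is tested with $w=v/(|v|+1/(n+1))$, an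
approximation of $v/|v|$ that is a multiple of $v$ by a bounded function; it gives $|v|^2\le
u\,(|v|+1/(n+1))$. -/
theorem isLUB_pnorm (v : H) : IsLUB {u : M →ₘ[μ] ℝ | ∃ w : H,
    (G.pnorm w : M →ₘ[μ] ℝ) ≤ 1 ∧ u = |(G.toCLM v w : M →ₘ[μ] ℝ)|} (G.pnorm v : M →ₘ[μ] ℝ) := by
  constructor
  · rintro u ⟨w, hw, rfl⟩
    rw [← AEEqFun.coeFn_le] at hw ⊢
    filter_upwards [hw, AEEqFun.coeFn_one (μ := μ) (β := ℝ) (α := M), G.ae_abs_le v w,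
      AEEqFun.coeFn_abs (G.toCLM v w : M →ₘ[μ] ℝ), G.pnorm_nonneg v] with x h1 h2 h3 h4 h5
    rw [h4]
    refine h3.trans (mul_le_of_le_one_right h5 ?_)
    rw [h2] at h1
    exact h1
  · intro u hu
    have key : ∀ n : ℕ, ∀ᵐ x ∂μ, G.pnorm v x * G.pnorm v x ≤ u x * (G.pnorm v x + 1 / (n + 1)) := by
      intro n
      have hn : (0 : ℝ) < 1 / (n + 1) := by positivity
      have hm : MemLp (fun x => (|G.pnorm v x| + 1 / ((n : ℝ) + 1))⁻¹) ∞ μ := by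
        refine memLp_top_of_bound (C := ((1 : ℝ) / (n + 1))⁻¹) ?_ (ae_of_all _ fun x => ?_)
        · have := (Lp.aestronglyMeasurable (G.pnorm v)).aemeasurable
          exact AEMeasurable.aestronglyMeasurable (by fun_prop)
        · rw [norm_inv]
          refine inv_anti₀ hn ?_
          rw [Real.norm_eq_abs]
          exact (le_add_of_nonneg_left (abs_nonneg _)).trans (le_abs_self _)
      have hf : hm.toLp =ᵐ[μ] _ := hm.coeFn_toLp
      have hw : (G.pnorm (G.smul hm.toLp v) : M →ₘ[μ] ℝ) ≤ 1 := by
        rw [← AEEqFun.coeFn_le]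
        filter_upwards [G.pnorm_smul hm.toLp v, hf, G.pnorm_nonneg v,
          AEEqFun.coeFn_one (μ := μ) (β := ℝ) (α := M)] with x h1 h2 h3 h4
        rw [h1, h2, h4, abs_of_nonneg h3, abs_inv, abs_of_nonneg (add_nonneg h3 hn.le),
          inv_mul_le_iff₀ (add_pos_of_nonneg_of_pos h3 hn)]
        simpa using hn.le
      have h := hu ⟨_, hw, rfl⟩
      rw [← AEEqFun.coeFn_le] at h
      filter_upwards [h, AEEqFun.coeFn_abs (G.toCLM v (G.smul hm.toLp v) : M →ₘ[μ] ℝ), hf,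
        G.toCLM_smul hm.toLp v v, G.pnorm_nonneg v, G.pnorm_sq v] with x h1 h2 h3 h4 h5 h6
      rw [h2, G.symm, h4, h3, ← h6, abs_of_nonneg h5] at h1
      have h0 : 0 < G.pnorm v x + 1 / ((n : ℝ) + 1) := add_pos_of_nonneg_of_pos h5 hn
      have h7 := (le_abs_self _).trans h1
      rw [inv_mul_le_iff₀ h0] at h7
      linarith
    rw [← AEEqFun.coeFn_le]
    filter_upwards [ae_all_iff.2 key, G.pnorm_nonneg v] with x hx h0
    have hlim : Tendsto (fun n : ℕ => u x * (G.pnorm v x + 1 / ((n : ℝ) + 1))) atTop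
        (𝓝 (u x * (G.pnorm v x + 0))) :=
      (tendsto_const_nhds.add tendsto_one_div_add_atTop_nhds_zero_nat).const_mul _
    have h1 := ge_of_tendsto' hlim hx
    rw [add_zero] at h1
    -- Where $|v|=0$ the limit inequality carries no information, but the case $n=0$ still gives
    -- $u\ge0$.
    rcases (show (0 : ℝ) ≤ G.pnorm v x from h0).eq_or_lt with h2 | h2
    · have h3 := hx 0
      rw [← h2] at h3 ⊢
      simpa using h3
    · exact le_of_mul_le_mul_right h1 h2

/-- The dual module as an `L²`-normed `L^∞`-module. -/
noncomputable def dualLinftyModule : NormedLinftyModule μ 2 G.linftyModule.Dual :=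
  G.linftyModule.congr G.sharpEquiv

theorem pnorm_sharp (v : H) : G.dualLinftyModule.pnorm (G.sharp v) = G.pnorm v :=
  congrArg G.pnorm (G.sharpEquiv.symm_apply_apply v)

/-- Every element of the dual is a sharp, so the transported operations can be compared with the
natural ones on elements of `H`. -/
theorem isDualStructure : G.linftyModule.IsDualStructure G.dualLinftyModule := by
  refine ⟨fun f L w => ?_, fun L => ?_⟩
  · obtain ⟨v, rfl⟩ := G.sharpEquiv.surjective L
    have h1 : G.dualLinftyModule.smul f (G.sharpEquiv v) = G.sharp (G.smul f v) :=
      congrArg (fun v => G.sharpEquiv (G.smul f v)) (G.sharpEquiv.symm_apply_apply v)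
    rw [h1]
    refine AEEqFun.ext ((G.toCLM_smul f v w).trans ?_)
    exact (AEEqFun.coeFn_mul (f : M →ₘ[μ] ℝ) (G.toCLM v w : M →ₘ[μ] ℝ)).symm
  · obtain ⟨v, rfl⟩ := G.sharpEquiv.surjective L
    rw [sharpEquiv_apply, pnorm_sharp]
    exact G.isLUB_pnorm v

theorem isHilbertModule_dual : G.dualLinftyModule.IsHilbertModule :=
  ⟨(innerₗ H).compl₁₂ G.sharpEquiv.symm.toLinearMap G.sharpEquiv.symm.toLinearMap,
    fun v w => real_inner_comm _ _,
    fun v => (real_inner_self_eq_norm_sq _).trans (by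
      exact congrArg (· ^ 2) (G.sharpEquiv.symm.norm_map v))⟩

end PointwiseInner

/-! ### Densities of the energy measures. -/

namespace DirichletForm

variable {M : Type*} [TopologicalSpace M] [MeasurableSpace M] {m : Measure M}
  {E : DirichletForm m} {μ : Measure M}

/-- Dominance concerns only $\mathcal F$; setwise convergence of the energy measures along an
approximating sequence carries it over to $\mathcal F_e$. -/
theorem IsDominant.energyOn_self_eq_zero (hμ : E.IsDominant μ) {A : Set M} (hA : MeasurableSet A)
    (h0 : μ A = 0) (f : E.extendedDomain) : E.energyOn A f f = 0 := by
  rw [energyOn_apply]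
  by_cases h : ∃ ν, E.IsEnergyMeasure ν
  · have hE : E.IsEnergyMeasure E.energyMeasure := by
      unfold energyMeasure
      rw [dif_pos h]
      exact h.choose_spec
    obtain ⟨u, hu⟩ := f.2
    have h1 := hE.approx u f hu A hA
    simp only [hμ.2 _ A hA h0] at h1
    exact (tendsto_nhds_unique tendsto_const_nhds h1).symm
  · simp [energyMeasure, dif_neg h]

theorem energyOn_sq_le (A : Set M) (f g : E.extendedDomain) :
    E.energyOn A f g ^ 2 ≤ E.energyOn A f f * E.energyOn A g g :=
  LinearMap.BilinForm.apply_sq_le_of_symm (E.energyOn A) (E.energyOn_nonneg A)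
    ⟨fun x y => E.energyOn_symm A x y⟩ f g

theorem integrable_carreDuChamp (f g : E.extendedDomain) :
    Integrable (E.carreDuChamp μ f g) μ :=
  SignedMeasure.integrable_rnDeriv _ _

theorem measurable_carreDuChamp (f g : E.extendedDomain) : Measurable (E.carreDuChamp μ f g) :=
  SignedMeasure.measurable_rnDeriv _ _

theorem carreDuChamp_symm (f g : E.extendedDomain) :
    E.carreDuChamp μ f g = E.carreDuChamp μ g f := by
  rw [carreDuChamp, energyMeasure_symm, carreDuChamp]

/-- Cauchy-Schwarz for the measures extends absolute continuity from $\boldsymbol\mu_f$ to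
$\boldsymbol\mu_{f,g}$, and Radon-Nikodym applies. The a.e. bilinearity and positivity of the
density are read off from this identity. -/
theorem IsDominant.setIntegral_carreDuChamp (hμ : E.IsDominant μ) {A : Set M}
    (hA : MeasurableSet A) (f g : E.extendedDomain) :
    ∫ x in A, E.carreDuChamp μ f g x ∂μ = E.energyOn A f g := by
  have := hμ.1
  have h : E.energyMeasure f g ≪ᵥ μ.toENNRealVectorMeasure := by
    refine VectorMeasure.AbsolutelyContinuous.mk fun s hs h0 => ?_
    rw [Measure.toENNRealVectorMeasure_apply_measurable hs] at h0
    have h1 := E.energyOn_sq_le s f g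
    rw [hμ.energyOn_self_eq_zero hs h0 f, zero_mul] at h1
    exact pow_eq_zero_iff two_ne_zero |>.1 (le_antisymm h1 (sq_nonneg _))
  rw [energyOn_apply, ← SignedMeasure.withDensityᵥ_rnDeriv_eq _ μ h,
    withDensityᵥ_apply (SignedMeasure.integrable_rnDeriv _ _) hA]
  rfl

theorem IsDominant.carreDuChamp_nonneg (hμ : E.IsDominant μ) (f : E.extendedDomain) :
    0 ≤ᵐ[μ] E.carreDuChamp μ f f := by
  refine ae_nonneg_of_forall_setIntegral_nonneg (integrable_carreDuChamp f f) fun s hs _ => ?_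
  rw [hμ.setIntegral_carreDuChamp hs]
  exact E.energyOn_nonneg s f

theorem IsDominant.carreDuChamp_add (hμ : E.IsDominant μ) (f f' g : E.extendedDomain) :
    ∀ᵐ x ∂μ, E.carreDuChamp μ (f + f') g x = E.carreDuChamp μ f g x + E.carreDuChamp μ f' g x := by
  refine (integrable_carreDuChamp _ _).ae_eq_of_forall_setIntegral_eq _ _
    ((integrable_carreDuChamp _ _).add (integrable_carreDuChamp _ _)) fun s hs _ => ?_
  rw [integral_add (integrable_carreDuChamp _ _).integrableOn
    (integrable_carreDuChamp _ _).integrableOn, hμ.setIntegral_carreDuChamp hs,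
    hμ.setIntegral_carreDuChamp hs, hμ.setIntegral_carreDuChamp hs, map_add, LinearMap.add_apply]

theorem IsDominant.carreDuChamp_smul (hμ : E.IsDominant μ) (c : ℝ) (f g : E.extendedDomain) :
    ∀ᵐ x ∂μ, E.carreDuChamp μ (c • f) g x = c * E.carreDuChamp μ f g x := by
  refine (integrable_carreDuChamp _ _).ae_eq_of_forall_setIntegral_eq _ _
    ((integrable_carreDuChamp _ _).const_mul c) fun s hs _ => ?_
  rw [integral_const_mul, hμ.setIntegral_carreDuChamp hs, hμ.setIntegral_carreDuChamp hs, map_smul,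
    LinearMap.smul_apply, smul_eq_mul]

theorem IsDominant.carreDuChamp_sq_le (hμ : E.IsDominant μ) (f g : E.extendedDomain) :
    ∀ᵐ x ∂μ, E.carreDuChamp μ f g x ^ 2 ≤ E.carreDuChamp μ f f x * E.carreDuChamp μ g g x := by
  refine ae_sq_le_mul_of_forall_ae_nonneg fun t => ?_
  filter_upwards [hμ.carreDuChamp_nonneg (f + t • g), hμ.carreDuChamp_add f (t • g) (f + t • g),
    hμ.carreDuChamp_smul t g (f + t • g), hμ.carreDuChamp_add f (t • g) f,
    hμ.carreDuChamp_add f (t • g) g, hμ.carreDuChamp_smul t g f, hμ.carreDuChamp_smul t g g]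
    with x h0 h1 h2 h3 h4 h5 h6
  rw [Pi.zero_apply, h1, h2, carreDuChamp_symm f, carreDuChamp_symm g (f + t • g), h3, h4, h5, h6,
    carreDuChamp_symm g f] at h0
  linarith

/-! ### The pointwise scalar product of sequences $(f_i,A_i)$. -/

namespace PreCotangent

/-- An almost everywhere property of each function holds for the functions prescribed by an element
of the pre-cotangent module. -/
theorem ae_val {p : E.extendedDomain → M → Prop} (h : ∀ f, ∀ᵐ x ∂μ, p f x) (P : PreCotangent E) :
    ∀ᵐ x ∂μ, p (P.val x) x := by
  filter_upwards [ae_all_iff.2 fun i => h (P.f i)] with x hx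
  obtain ⟨i, hi⟩ := P.exists_mem x
  rw [P.val_eq hi]
  exact hx i

variable (μ) in
/-- The pointwise scalar product of `(f_i, A_i)` and `(g_j, B_j)`: the function that is
`Γ_μ(f_i, g_j)` on `A_i ∩ B_j`. -/
noncomputable def gamma (P Q : PreCotangent E) (x : M) : ℝ :=
  E.carreDuChamp μ (P.val x) (Q.val x) x

theorem gamma_symm (P Q : PreCotangent E) : gamma μ P Q = gamma μ Q P :=
  funext fun _ => congrFun (carreDuChamp_symm _ _) _

theorem gamma_eq_of_mem {P Q : PreCotangent E} {x : M} {i j : ℕ} (hi : x ∈ P.A i)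
    (hj : x ∈ Q.A j) : gamma μ P Q x = E.carreDuChamp μ (P.f i) (Q.f j) x := by
  rw [gamma, P.val_eq hi, Q.val_eq hj]

theorem measurable_gamma (P Q : PreCotangent E) : Measurable (gamma μ P Q) := by
  intro s hs
  have h : gamma μ P Q ⁻¹' s = ⋃ i, ⋃ j,
      P.A i ∩ Q.A j ∩ E.carreDuChamp μ (P.f i) (Q.f j) ⁻¹' s := by
    ext x
    obtain ⟨i, hi⟩ := P.exists_mem x
    obtain ⟨j, hj⟩ := Q.exists_mem x
    simp only [mem_preimage, mem_iUnion, mem_inter_iff]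
    constructor
    · intro hx
      exact ⟨i, j, ⟨hi, hj⟩, gamma_eq_of_mem (μ := μ) hi hj ▸ hx⟩
    · rintro ⟨k, l, ⟨hk, hl⟩, hx⟩
      exact (gamma_eq_of_mem (μ := μ) hk hl).symm ▸ hx
  rw [h]
  exact MeasurableSet.iUnion fun i => MeasurableSet.iUnion fun j =>
    ((P.measurable i).inter (Q.measurable j)).inter (measurable_carreDuChamp _ _ hs)

section Dominant

variable (hμ : E.IsDominant μ)
include hμ

theorem gamma_nonneg (P : PreCotangent E) : 0 ≤ᵐ[μ] gamma μ P P :=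
  ae_val hμ.carreDuChamp_nonneg P

/-- The null set depends on the functions, but a sequence prescribes only countably many; `ae_val`
is nested, once for each slot. -/
theorem gamma_sq_le (P Q : PreCotangent E) :
    ∀ᵐ x ∂μ, gamma μ P Q x ^ 2 ≤ gamma μ P P x * gamma μ Q Q x :=
  ae_val (p := fun f x => E.carreDuChamp μ f (Q.val x) x ^ 2
      ≤ E.carreDuChamp μ f f x * E.carreDuChamp μ (Q.val x) (Q.val x) x)
    (fun f => ae_val (p := fun g x => E.carreDuChamp μ f g x ^ 2
      ≤ E.carreDuChamp μ f f x * E.carreDuChamp μ g g x) (hμ.carreDuChamp_sq_le f) Q) P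

theorem gamma_add (P P' Q : PreCotangent E) :
    ∀ᵐ x ∂μ, gamma μ (P.add P') Q x = gamma μ P Q x + gamma μ P' Q x := by
  have h := ae_val (p := fun f x => E.carreDuChamp μ (f + P'.val x) (Q.val x) x
      = E.carreDuChamp μ f (Q.val x) x + E.carreDuChamp μ (P'.val x) (Q.val x) x)
    (fun f => ae_val (p := fun f' x => E.carreDuChamp μ (f + f') (Q.val x) x
      = E.carreDuChamp μ f (Q.val x) x + E.carreDuChamp μ f' (Q.val x) x)
      (fun f' => ae_val (p := fun g x => E.carreDuChamp μ (f + f') g x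
      = E.carreDuChamp μ f g x + E.carreDuChamp μ f' g x) (hμ.carreDuChamp_add f f') Q) P') P
  filter_upwards [h] with x hx
  rw [gamma, val_add]
  exact hx

theorem carreDuChamp_smul_val (c : ℝ) (P Q : PreCotangent E) :
    ∀ᵐ x ∂μ, E.carreDuChamp μ (c • P.val x) (Q.val x) x = c * gamma μ P Q x :=
  ae_val (p := fun f x => E.carreDuChamp μ (c • f) (Q.val x) x
      = c * E.carreDuChamp μ f (Q.val x) x)
    (fun f => ae_val (p := fun g x => E.carreDuChamp μ (c • f) g x
      = c * E.carreDuChamp μ f g x) (hμ.carreDuChamp_smul c f) Q) P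

theorem gamma_smul (c : ℝ) (P Q : PreCotangent E) :
    ∀ᵐ x ∂μ, gamma μ (P.smul c) Q x = c * gamma μ P Q x := by
  filter_upwards [carreDuChamp_smul_val hμ c P Q] with x hx
  rw [gamma, val_smul, hx]

/-- A simple function has finitely many values, so homogeneity holds off one null set for all of
them. This supplies both the cut-off by indicators and the formula for products with simple
functions. -/
theorem gamma_simpleSMul (h : SimpleFunc M ℝ) (P Q : PreCotangent E) :
    ∀ᵐ x ∂μ, gamma μ (P.simpleSMul h) Q x = h x * gamma μ P Q x := by
  have h1 : ∀ᵐ x ∂μ, ∀ c : h.range, E.carreDuChamp μ ((c : ℝ) • P.val x) (Q.val x) x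
      = c * gamma μ P Q x := ae_all_iff.2 fun c => carreDuChamp_smul_val hμ c P Q
  filter_upwards [h1] with x hx
  have h2 : (P.simpleSMul h).val x = h x • P.val x := by
    obtain ⟨i, hi⟩ := P.exists_mem x
    rw [P.val_eq hi]
    let : Encodable h.range := Encodable.ofCountable _
    exact val_ofCountable (A := fun p : ℕ × h.range => P.A p.1 ∩ h ⁻¹' {(p.2 : ℝ)})
      (f := fun p : ℕ × h.range => (p.2 : ℝ) • P.f p.1) (i := (i, ⟨h x, h.mem_range_self x⟩))
      ⟨hi, rfl⟩
  rw [gamma, h2]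
  exact hx ⟨h x, h.mem_range_self x⟩

theorem setIntegral_gamma_self (P : PreCotangent E) (i : ℕ) :
    ∫ x in P.A i, gamma μ P P x ∂μ = E.energyOn (P.A i) (P.f i) (P.f i) := by
  rw [← hμ.setIntegral_carreDuChamp (P.measurable i)]
  exact setIntegral_congr_fun (P.measurable i) fun x hx => gamma_eq_of_mem hx hx

/-- The summability required of a sequence is exactly integrability, as
$\int_{A_i}|\gamma|\,d\mu=\boldsymbol\mu_{f_i}[A_i]$ for $\gamma$ the diagonal value of `gamma`. -/
theorem integrable_gamma_self (P : PreCotangent E) : Integrable (gamma μ P P) μ := by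
  rw [← integrableOn_univ, ← P.cover]
  refine integrableOn_iUnion_of_summable_integral_norm (fun i => ?_)
    (P.summable.congr fun i => ?_)
  · exact (integrable_carreDuChamp (P.f i) (P.f i)).integrableOn.congr_fun
      (fun x hx => (gamma_eq_of_mem hx hx).symm) (P.measurable i)
  · rw [← setIntegral_gamma_self hμ]
    refine integral_congr_ae (ae_restrict_of_ae ?_)
    filter_upwards [gamma_nonneg hμ P] with x hx
    exact (Real.norm_of_nonneg hx).symm

theorem integral_gamma_self (P : PreCotangent E) : ∫ x, gamma μ P P x ∂μ = P.normSq := by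
  rw [← setIntegral_univ, ← P.cover, integral_iUnion P.measurable P.disjoint
    (integrable_gamma_self hμ P).integrableOn]
  exact tsum_congr (setIntegral_gamma_self hμ P)

theorem integrable_gamma (P Q : PreCotangent E) : Integrable (gamma μ P Q) μ := by
  refine ((integrable_gamma_self hμ P).add (integrable_gamma_self hμ Q)).mono'
    (measurable_gamma P Q).aestronglyMeasurable ?_
  filter_upwards [gamma_nonneg hμ P, gamma_nonneg hμ Q, gamma_sq_le hμ P Q] with x h1 h2 h3
  simp only [Pi.zero_apply] at h1 h2
  refine abs_le_of_sq_le_sq (h3.trans ?_) (add_nonneg h1 h2)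
  rw [Pi.add_apply]
  nlinarith [mul_nonneg h1 h2]

/-- Equivalence means that the diagonal value at $P-P'$ has integral zero, hence vanishes a.e.;
Cauchy-Schwarz then annihilates the pairing of $P-P'$ with `Q`. -/
theorem Rel.gamma_eq {P P' : PreCotangent E} (h : Rel P P') (Q : PreCotangent E) :
    gamma μ P Q =ᵐ[μ] gamma μ P' Q := by
  rw [rel_iff_normSq, ← integral_gamma_self hμ,
    integral_eq_zero_iff_of_nonneg_ae (gamma_nonneg hμ _) (integrable_gamma_self hμ _)] at h
  filter_upwards [h, gamma_sq_le hμ (P.add (PreCotangent.smul (-1) P')) Q,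
    gamma_add hμ P (PreCotangent.smul (-1) P') Q, gamma_smul hμ (-1) P' Q] with x h1 h2 h3 h4
  rw [h1, Pi.zero_apply, zero_mul] at h2
  have h5 := pow_eq_zero_iff two_ne_zero |>.1 (le_antisymm h2 (sq_nonneg _))
  linarith

end Dominant

end PreCotangent

/-! ### Descent to equivalence classes. -/

namespace PreCotangentClass

open PreCotangent

/-- The pointwise scalar product on the space of classes `[f_i, A_i]`. -/
noncomputable def gammaL1 (hμ : E.IsDominant μ) (v w : PreCotangentClass E) : Lp ℝ 1 μ :=
  Quotient.liftOn₂ v w (fun P Q => (integrable_gamma hμ P Q).toL1 (gamma μ P Q))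
    fun P Q P' Q' h h' => (Integrable.toL1_eq_toL1_iff _ _ _ _).2 <| by
      refine (Rel.gamma_eq hμ h Q).trans ?_
      rw [gamma_symm P', gamma_symm P']
      exact Rel.gamma_eq hμ h' P'

theorem coeFn_gammaL1 (hμ : E.IsDominant μ) (P Q : PreCotangent E) :
    gammaL1 hμ (mk P) (mk Q) =ᵐ[μ] gamma μ P Q :=
  Integrable.coeFn_toL1 (integrable_gamma hμ P Q)

theorem gammaL1_symm (hμ : E.IsDominant μ) (v w : PreCotangentClass E) :
    gammaL1 hμ v w = gammaL1 hμ w v := by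
  induction v using ind with | _ P
  induction w using ind with | _ Q
  refine Lp.ext ((coeFn_gammaL1 hμ P Q).trans ?_)
  rw [gamma_symm]
  exact (coeFn_gammaL1 hμ Q P).symm

theorem gammaL1_add (hμ : E.IsDominant μ) (v v' w : PreCotangentClass E) :
    gammaL1 hμ (v + v') w = gammaL1 hμ v w + gammaL1 hμ v' w := by
  induction v using ind with | _ P
  induction v' using ind with | _ P'
  induction w using ind with | _ Q
  refine Lp.ext ?_
  filter_upwards [coeFn_gammaL1 hμ (P.add P') Q, coeFn_gammaL1 hμ P Q, coeFn_gammaL1 hμ P' Q,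
    gamma_add hμ P P' Q, Lp.coeFn_add (gammaL1 hμ (mk P) (mk Q)) (gammaL1 hμ (mk P') (mk Q))]
    with x h1 h2 h3 h4 h5
  rw [mk_add, h1, h4, h5, Pi.add_apply, h2, h3]

theorem gammaL1_smul (hμ : E.IsDominant μ) (c : ℝ) (v w : PreCotangentClass E) :
    gammaL1 hμ (c • v) w = c • gammaL1 hμ v w := by
  induction v using ind with | _ P
  induction w using ind with | _ Q
  refine Lp.ext ?_
  filter_upwards [coeFn_gammaL1 hμ (P.smul c) Q, coeFn_gammaL1 hμ P Q, gamma_smul hμ c P Q,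
    Lp.coeFn_smul c (gammaL1 hμ (mk P) (mk Q))] with x h1 h2 h3 h4
  rw [smul_mk, h1, h3, h4, Pi.smul_apply, h2, smul_eq_mul]

theorem norm_gammaL1_le (hμ : E.IsDominant μ) (v w : PreCotangentClass E) :
    ‖gammaL1 hμ v w‖ ≤ ‖v‖ * ‖w‖ := by
  induction v using ind with | _ P
  induction w using ind with | _ Q
  rw [L1.norm_eq_integral_norm, norm_mk, norm_mk, ← integral_gamma_self hμ,
    ← integral_gamma_self hμ]
  refine le_trans (le_of_eq (integral_congr_ae ?_)) (integral_abs_le_sqrt_mul_sqrt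
    (integrable_gamma hμ P P) (integrable_gamma hμ P Q) (integrable_gamma hμ Q Q)
    (gamma_nonneg hμ P) (gamma_nonneg hμ Q) (gamma_sq_le hμ P Q))
  filter_upwards [coeFn_gammaL1 hμ P Q] with x hx
  rw [hx, Real.norm_eq_abs]

/-- The pointwise scalar product as a continuous bilinear map. -/
noncomputable def gammaCLM (hμ : E.IsDominant μ) :
    PreCotangentClass E →L[ℝ] PreCotangentClass E →L[ℝ] Lp ℝ 1 μ :=
  (LinearMap.mk₂ ℝ (gammaL1 hμ) (gammaL1_add hμ) (gammaL1_smul hμ)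
    (fun u v w => by simp only [gammaL1_symm hμ u, gammaL1_add])
    (fun c v w => by simp only [gammaL1_symm hμ v, gammaL1_smul])).mkContinuous₂ 1
    fun v w => by
      rw [one_mul]
      exact norm_gammaL1_le hμ v w

end PreCotangentClass

/-! ### Extension to the cotangent module. -/

section Completion

open UniformSpace PreCotangent

/-- The pointwise scalar product on the cotangent module. -/
noncomputable def cotangentInner (hμ : E.IsDominant μ) :
    E.CotangentModule →L[ℝ] E.CotangentModule →L[ℝ] Lp ℝ 1 μ :=
  -- One variable is extended at a time. The flip leaves the two arguments interchanged, which is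
  -- harmless by symmetry.
  ((PreCotangentClass.gammaCLM hμ).extend Completion.toComplL).flip.extend Completion.toComplL

theorem cotangentInner_coe (hμ : E.IsDominant μ) (v w : PreCotangentClass E) :
    cotangentInner hμ v w = PreCotangentClass.gammaL1 hμ v w := by
  have hd : DenseRange (Completion.toComplL (𝕜 := ℝ) (E := PreCotangentClass E)) :=
    Completion.denseRange_coe
  have hu : IsUniformInducing (Completion.toComplL (𝕜 := ℝ) (E := PreCotangentClass E)) :=
    Completion.isUniformInducing_coe _
  have h1 := ContinuousLinearMap.extend_eq
    ((PreCotangentClass.gammaCLM hμ).extend Completion.toComplL).flip hd hu v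
  have h2 := ContinuousLinearMap.extend_eq (PreCotangentClass.gammaCLM hμ) hd hu w
  refine (congrArg (fun L => L (w : E.CotangentModule)) h1).trans ?_
  refine (congrArg (fun L => L v) h2).trans ?_
  exact PreCotangentClass.gammaL1_symm hμ w v

theorem coeFn_cotangentInner (hμ : E.IsDominant μ) (P Q : PreCotangent E) :
    cotangentInner hμ (E.toCotangent P) (E.toCotangent Q) =ᵐ[μ] gamma μ P Q := by
  rw [toCotangent, toCotangent, cotangentInner_coe]
  exact PreCotangentClass.coeFn_gammaL1 hμ P Q

theorem denseRange_toCotangent : DenseRange E.toCotangent :=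
  Completion.denseRange_coe.comp
    (Function.Surjective.denseRange (f := PreCotangentClass.mk) Quotient.mk_surjective)
    (Completion.continuous_coe _)

theorem cotangentInner_symm (hμ : E.IsDominant μ) (v w : E.CotangentModule) :
    cotangentInner hμ v w = cotangentInner hμ w v := by
  induction v, w using Completion.induction_on₂ with
  | hp => exact isClosed_eq (by fun_prop) (by fun_prop)
  | ih v w => rw [cotangentInner_coe, cotangentInner_coe, PreCotangentClass.gammaL1_symm]

theorem cotangentInner_nonneg (hμ : E.IsDominant μ) (v : E.CotangentModule) :
    0 ≤ cotangentInner hμ v v := by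
  refine denseRange_toCotangent.induction_on v
    (isClosed_le continuous_const (by fun_prop)) fun P => ?_
  rw [← Lp.coeFn_nonneg]
  filter_upwards [coeFn_cotangentInner hμ P P, gamma_nonneg hμ P] with x h1 h2
  rw [h1]
  exact h2

/-- This makes the norm of the completion a Hilbert norm, so a scalar product can be put on it
without changing the norm. -/
theorem integral_cotangentInner_self (hμ : E.IsDominant μ) (v : E.CotangentModule) :
    L1.integralCLM (cotangentInner hμ v v) = ‖v‖ ^ 2 := by
  refine denseRange_toCotangent.induction_on v
    (isClosed_eq (by fun_prop) (by fun_prop)) fun P => ?_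
  rw [← L1.integral_eq, L1.integral_eq_integral, integral_congr_ae (coeFn_cotangentInner hμ P P),
    integral_gamma_self hμ, toCotangent, Completion.norm_coe, PreCotangentClass.norm_mk,
    Real.sq_sqrt P.normSq_nonneg]

/-- The scalar product of the cotangent module, the integral of the pointwise one. -/
@[reducible]
noncomputable def cotangentInnerProductSpace (hμ : E.IsDominant μ) :
    InnerProductSpace ℝ E.CotangentModule where
  inner v w := L1.integralCLM (cotangentInner hμ v w)
  norm_sq_eq_re_inner v := (integral_cotangentInner_self hμ v).symm
  conj_inner_symm v w := congrArg L1.integralCLM (cotangentInner_symm hμ w v)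
  add_left u v w := by simp
  smul_left v w c := by simp

/-- The cotangent module with its pointwise scalar product. -/
noncomputable def cotangentPointwiseInner (hμ : E.IsDominant μ) :
    letI := cotangentInnerProductSpace hμ
    PointwiseInner μ E.CotangentModule :=
  letI := cotangentInnerProductSpace hμ
  { toCLM := cotangentInner hμ
    symm := cotangentInner_symm hμ
    nonneg := fun v => (Lp.coeFn_nonneg _).2 (cotangentInner_nonneg hμ v)
    integral_eq := fun v w => by
      change _ = L1.integralCLM (cotangentInner hμ v w)
      rw [← L1.integral_eq, L1.integral_eq_integral]
    exists_indicator := by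
      refine ⟨range E.toCotangent, denseRange_toCotangent, ?_⟩
      rintro A hA _ ⟨P, rfl⟩
      let h : SimpleFunc M ℝ := SimpleFunc.piecewise A hA (SimpleFunc.const M 1)
        (SimpleFunc.const M 0)
      refine ⟨E.toCotangent (P.simpleSMul h), ?_⟩
      rintro _ ⟨Q, rfl⟩
      filter_upwards [coeFn_cotangentInner hμ P Q, coeFn_cotangentInner hμ (P.simpleSMul h) Q,
        gamma_simpleSMul hμ h P Q] with x h1 h2 h3
      rw [h2, h3]
      by_cases hx : x ∈ A <;> simp [h, hx, h1] }

end Completion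

/-- At each point only the piece of the partition containing it contributes. -/
theorem tsum_indicator_sqrt_carreDuChamp (P : PreCotangent E) (x : M) :
    ∑' i, (P.A i).indicator (fun y => √(E.carreDuChamp μ (P.f i) (P.f i) y)) x
      = √(PreCotangent.gamma μ P P x) := by
  obtain ⟨i, hi⟩ := P.exists_mem x
  rw [tsum_eq_single i fun j hj => indicator_of_notMem (fun h => hj (P.eq_of_mem h hi)) _,
    indicator_of_mem hi, PreCotangent.gamma_eq_of_mem hi hi]

/-- The sequences $(f,M)+(g,M)$ and $(f+g,M)$ are indexed differently but prescribe the same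
function at every point, which suffices for equivalence. -/
theorem isLinearMap_differential : IsLinearMap ℝ E.differential where
  map_add f g := by
    refine Eq.trans ?_ (UniformSpace.Completion.coe_add _ _)
    refine congrArg _ (PreCotangentClass.sound fun x => ?_)
    simp only [PreCotangent.val_add, PreCotangent.val_single]
  map_smul c f := by
    refine Eq.trans ?_ (UniformSpace.Completion.coe_smul c _)
    refine congrArg _ (PreCotangentClass.sound fun x => ?_)
    simp only [PreCotangent.val_smul, PreCotangent.val_single]

end DirichletForm

/-! ### The theorem. -/

theorem mainTheorem3 {M : Type*} [TopologicalSpace M] [MeasurableSpace M] [BorelSpace M]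
    (hM : IsLusinSpace M) (m : Measure M) [SigmaFinite m] [m.IsOpenPosMeasure]
    (E : DirichletForm m) (hreg : E.IsQuasiRegular) (hloc : E.IsStronglyLocal)
    (μ : Measure M) (hμ : E.IsDominant μ) :
    -- the cotangent module is a Hilbert module with respect to `μ`, with the multiplication that
    -- extends the one by simple functions and the pointwise norm `∑ i, 1_{A_i} Γ_μ(f_i)^{1/2}`
    ∃ S : NormedLinftyModule μ 2 E.CotangentModule,
      (∀ (h : SimpleFunc M ℝ) (g : Lp ℝ ∞ μ) (P : DirichletForm.PreCotangent E), g =ᵐ[μ] h →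
        S.smul g (E.toCotangent P) = E.toCotangent (P.simpleSMul h)) ∧
      (∀ P : DirichletForm.PreCotangent E, S.pnorm (E.toCotangent P) =ᵐ[μ] fun x =>
        ∑' i, (P.A i).indicator (fun y => √(E.carreDuChamp μ (P.f i) (P.f i) y)) x) ∧
      S.IsHilbertModule ∧
      -- the differential
      IsLinearMap ℝ E.differential ∧
      (∀ f, S.pnorm (E.differential f) =ᵐ[μ] fun x => √(E.carreDuChamp μ f f x)) ∧
      -- the tangent module is the dual module; it is a Hilbert module
      ∃ T : NormedLinftyModule μ 2 S.Dual,
        S.IsDualStructure T ∧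
        T.IsHilbertModule ∧
        -- the gradient `∇ f = (d f)♯`
        ∃ grad : E.extendedDomain →ₗ[ℝ] S.Dual,
          (∀ f, S.IsSharp (E.differential f) (grad f)) ∧
          ∀ f, T.pnorm (grad f) =ᵐ[μ] fun x => √(E.carreDuChamp μ f f x) := by
  let := DirichletForm.cotangentInnerProductSpace hμ
  let G : PointwiseInner μ E.CotangentModule := DirichletForm.cotangentPointwiseInner hμ
  have hp : ∀ P : DirichletForm.PreCotangent E, G.pnorm (E.toCotangent P) =ᵐ[μ]
      fun x => √(DirichletForm.PreCotangent.gamma μ P P x) := fun P => by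
    filter_upwards [G.coeFn_pnorm (E.toCotangent P), DirichletForm.coeFn_cotangentInner hμ P P]
      with x h1 h2
    exact h1.trans (congrArg _ h2)
  have hd : ∀ f, G.pnorm (E.differential f) =ᵐ[μ] fun x => √(E.carreDuChamp μ f f x) := fun f => by
    filter_upwards [hp (DirichletForm.PreCotangent.single f)] with x hx
    rw [DirichletForm.PreCotangent.gamma, DirichletForm.PreCotangent.val_single] at hx
    exact hx
  refine ⟨G.linftyModule, fun h g P hg => ?_, fun P => ?_, G.linftyModule.isHilbertModule,
    DirichletForm.isLinearMap_differential, hd, G.dualLinftyModule, G.isDualStructure,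
    G.isHilbertModule_dual, G.sharp.comp (DirichletForm.isLinearMap_differential.mk' _),
    fun f => G.isSharp _, fun f => ?_⟩
  -- The abstract Riesz product is recognised as the explicit one by pairing with the dense set of
  -- classes.
  · refine G.smul_eq_of_forall DirichletForm.denseRange_toCotangent ?_
    rintro _ ⟨Q, rfl⟩
    filter_upwards [DirichletForm.coeFn_cotangentInner hμ P Q,
      DirichletForm.coeFn_cotangentInner hμ (P.simpleSMul h) Q,
      DirichletForm.PreCotangent.gamma_simpleSMul hμ h P Q, hg] with x h1 h2 h3 h4
    rw [h4]
    exact h2.trans (h3.trans (congrArg _ h1.symm))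
  · simp only [DirichletForm.tsum_indicator_sqrt_carreDuChamp]
    exact hp P
  · rw [LinearMap.comp_apply, G.pnorm_sharp]
    exact hd f
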